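/- **Theorem.** Let $Y$ be the oriented multigraph with vertices $[p]$ ($p\ge 0$) and edges $\varepsilon_p^i:[p-1]\to[p]$ ($p\ge 1$, $0\le i\le p$), $\eta_q^j:[q+1]\to[q]$ ($0\le j\le q$), $t_q:[q]\to[q]$ ($q\ge 0$). Let $C(Y)$ be the free category on $Y$; its morphisms are the paths, written as words with the edge applied last on the left. Let $S$ be the set of relations (for all indices for which both sides are defined) $$f:\ \varepsilon_{q+1}^i\varepsilon_q^{j-1}=\varepsilon_{q+1}^j\varepsilon_q^i\ (j>i),\qquad g:\ \eta_q^j\eta_{q+1}^i=\eta_q^i\eta_{q+1}^{j+1}\ (j\ge i),$$ $$h:\ \eta_{q-1}^j\varepsilon_q^i=\begin{cases}\varepsilon_{q-1}^i\eta_{q-2}^{j-1}, & j>i,\\ 1_{[q-1]}, & i=j,\ i=j+1,\\ \varepsilon_{q-1}^{i-1}\eta_{q-2}^j, & i>j+1,\end{cases}$$ $$\rho_1:\ t_q\varepsilon_q^i=\varepsilon_q^{i-1}t_{q-1}\ (1\le i\le q),\qquad \rho_2:\ t_q\eta_q^i=\eta_q^{i-1}t_{q+1}\ (1\le i\le q),\qquad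 \rho_3:\ t_q^{q+1}=1_{[q]}.$$ Let $\Lambda=C(Y|S)$, the quotient of $C(Y)$ by the congruence generated by $S$, be the cyclic category, and let $S^C=S\cup\{\rho_4,\rho_5\}$, where $\rho_4:\ t_q\varepsilon_q^0=\varepsilon_q^q$ ($q\ge1$) and $\rho_5:\ t_q\eta_q^0=\eta_q^q t_{q+1}^2$ ($q\ge 0$). Let $k$ be a field. For a category $\mathscr C$, let $k\mathscr C$ be its category partial algebra: the formal $k$-linear combinations of morphisms with common domain and common codomain, with the multiplication that extends composition bilinearly. A relation $u=v$ is identified with $u-v\in kC(Y)$, and $\mathrm{Id}(T)$ is the ideal of $kC(Y)$ generated by $T$. *The order $\succ_2$ on $C(Y)$.* Every tuple below is compared lexicographically. - Put $t_p^i>t_q^j$ iff $i>j$, or $i=j$ and $p>q$ (where $t_p^0=1_{[p]}$). Put $\eta_p^i>\eta_q^j$ iff $p>q$, or $p=q$ and $i<j$; likewise for the letters $\varepsilon$. - A word $v=w_0\eta_{p_1}^{i_1}w_1\cdots\eta_{p_n}^{i_n}w_n$, where each $w_l$ is a power of some $t_p$, has weight $(n,w_0,\dots,w_n,\eta_{p_n}^{i_n},\dots,\eta_{p_1}^{i_1})$,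 and such words are compared by their weights. - A word $u=v_0\varepsilon_{p_1}^{i_1}v_1\cdots\varepsilon_{p_n}^{i_n}v_n$, where each $v_l$ contains no $\varepsilon$, has weight $wt(u)=(n,v_0,\dots,v_n,\varepsilon_{p_1}^{i_1},\dots,\varepsilon_{p_n}^{i_n})$, and $u\succ_2 v$ iff $wt(u)>wt(v)$. *Gröbner–Shirshov bases.* A monomial order on $C(Y)$ is a well-ordering $>$ of the morphisms such that $u>v$ implies $uw>vw$ and $wu>wv$ whenever these products are defined. For $0\ne f\in kC(Y)$ let $\bar f$ be its largest word; $f$ is monic if $\bar f$ has coefficient $1$. For monic $f,g$ the compositions are $(f,g)_w=f-agb$ where $w=\bar f=a\bar g b$, and $(f,g)_w=fb-ag$ where $w=\bar f b=a\bar g$, with words $a,b$. A nonempty set $T\subset kC(Y)$ of monic elements is a Gröbner–Shirshov basis with respect to a monomial order if each composition $(f,g)_w$ of elements $f,g\in T$ is a finite sum $\sum_l\alpha_l a_ls_lb_l$ with $\alpha_l\in k$, words $a_l,b_l$, and $s_l\in T$ such that $a_l\bar s_lb_l<w$. Then: 1. $\mathrm{Id}(S^C)=\mathrm{Id}(S)$.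 The order $\succ_2$ is a monomial order, and with respect to it $S^C$ is a Gröbner–Shirshov basis in $kC(Y)$. It is one for $kC(Y|S)$, that is, $\mathrm{Id}(S^C)$ is the kernel of the canonical linear map $kC(Y)\to kC(Y|S)$. 2. For all $p,q\ge0$, every morphism $\mu:[q]\to[p]$ of $\Lambda$ is represented by exactly one word of the form $$\varepsilon_p^{i_1}\cdots\varepsilon_{p-m+1}^{i_m}\,\eta_{q-n}^{j_1}\cdots\eta_{q-1}^{j_n}\,t_q^e,$$ where $m,n\ge 0$, $p\ge i_1>\cdots>i_m\ge0$, $0\le j_1<\cdots<j_n<q$, $0\le e\le q$ and $q-n+m=p$. -/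

import Mathlib

open CategoryTheory

noncomputable section

/-! ## Category partial algebras and Groebner-Shirshov bases

Morphisms are composed in diagrammatic order: the product written `v u` (first `u`, then `v`) on
paper is `u ≫ v` here. -/

namespace CatAlg

universe w v u

variable {k : Type w} [Field k] {C : Type u} [Category.{v} C]

/-- The component of the category partial algebra `kC` at the pair of objects `X, Y`:
formal `k`-linear combinations of morphisms with domain `X` and codomain `Y`. -/
abbrev Poly (k : Type w) [Field k] {C : Type u} [Category.{v} C] (X Y : C) : Type (max v w) :=
  (X ⟶ Y) →₀ k

/-- A morphism of `C`, viewed as an element of `kC`. -/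
def word (k : Type w) [Field k] {C : Type u} [Category.{v} C] {X Y : C} (u : X ⟶ Y) :
    Poly k X Y :=
  Finsupp.single u 1

/-- The partial multiplication of `kC`: the bilinear extension of composition. -/
def mul {X Y Z : C} (f : Poly k X Y) (g : Poly k Y Z) : Poly k X Z :=
  f.sum fun u r => g.sum fun v s => Finsupp.single (u ≫ v) (r * s)

/-- A set of elements of `kC`. -/
abbrev PolySet (k : Type w) [Field k] (C : Type u) [Category.{v} C] : Type (max u v w) :=
  ∀ ⦃X Y : C⦄, Set (Poly k X Y)

/-- The set of all `u - v`, where `u = v` is one of the relations in `R`. -/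
def polys (k : Type w) [Field k] {C : Type u} [Category.{v} C] (R : HomRel C) : PolySet k C :=
  fun _ _ => {f | ∃ u v, R u v ∧ f = word k u - word k v}

/-- Membership in the (two-sided) ideal of `kC` generated by `S`: the least family of
linear subspaces that contains `S` and is closed under multiplication on either side. -/
inductive MemIdeal (S : PolySet k C) : ∀ {X Y : C}, Poly k X Y → Prop
  | of {X Y : C} {s : Poly k X Y} (hs : s ∈ @S X Y) : MemIdeal S s
  | zero {X Y : C} : MemIdeal S (0 : Poly k X Y)
  | add {X Y : C} {f g : Poly k X Y} : MemIdeal S f → MemIdeal S g → MemIdeal S (f + g)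
  | smul {X Y : C} (c : k) {f : Poly k X Y} : MemIdeal S f → MemIdeal S (c • f)
  | mul_left {X Y Z : C} (f : Poly k X Y) {g : Poly k Y Z} : MemIdeal S g → MemIdeal S (mul f g)
  | mul_right {X Y Z : C} {f : Poly k X Y} (g : Poly k Y Z) : MemIdeal S f → MemIdeal S (mul f g)

/-- `Id(S)`. -/
def Id (S : PolySet k C) : PolySet k C := fun _ _ => {f | MemIdeal S f}

/-- A monomial order on the morphisms of `C` (`lt u v` means `u < v`): a well-ordering that is
preserved by left and right multiplication, whenever the products are defined. -/
structure IsMonomialOrder (lt : Arrow C → Arrow C → Prop) : Prop where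
  wellOrder : IsWellOrder (Arrow C) lt
  comp_post : ∀ {X X' Y Z : C} (u : X ⟶ Y) (v : X' ⟶ Y) (w : Y ⟶ Z),
    lt (Arrow.mk v) (Arrow.mk u) → lt (Arrow.mk (v ≫ w)) (Arrow.mk (u ≫ w))
  comp_pre : ∀ {X Y Z Z' : C} (w : X ⟶ Y) (u : Y ⟶ Z) (v : Y ⟶ Z'),
    lt (Arrow.mk v) (Arrow.mk u) → lt (Arrow.mk (w ≫ v)) (Arrow.mk (w ≫ u))

variable (lt : Arrow C → Arrow C → Prop)

/-- `u` is the leading word of `f`. -/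
def IsLeadingWord {X Y : C} (f : Poly k X Y) (u : X ⟶ Y) : Prop :=
  f u ≠ 0 ∧ ∀ v : X ⟶ Y, f v ≠ 0 → v ≠ u → lt (Arrow.mk v) (Arrow.mk u)

/-- `f` has a leading word, and its coefficient is `1`. -/
def IsMonic {X Y : C} (f : Poly k X Y) : Prop :=
  ∃ u : X ⟶ Y, IsLeadingWord lt f u ∧ f u = 1

/-- The elements that are congruent to `0` modulo `(S, w)`: linear combinations of `S`-words
`a s b` whose leading words `a s̄ b` are smaller than `w`. -/
def trivialMod (S : PolySet k C) {X Y : C} (w : X ⟶ Y) : Submodule k (Poly k X Y) :=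
  Submodule.span k {f | ∃ (A B : C) (s : Poly k A B) (s' : A ⟶ B) (b : X ⟶ A) (a : B ⟶ Y),
    s ∈ @S A B ∧ IsLeadingWord lt s s' ∧
    lt (Arrow.mk (b ≫ s' ≫ a)) (Arrow.mk w) ∧
    f = mul (word k b) (mul s (word k a))}

/-- `S` is a Groebner-Shirshov basis in `kC` with respect to the monomial order `lt`: it is a
non-empty set of monic elements, and all compositions of its elements are trivial. -/
structure IsGroebnerShirshovBasis (S : PolySet k C) : Prop where
  monomialOrder : IsMonomialOrder lt
  nonempty : ∃ X Y : C, (@S X Y).Nonempty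
  monic : ∀ {X Y : C} (s : Poly k X Y), s ∈ @S X Y → IsMonic lt s
  /-- Compositions of inclusion: `w = f̄ = a ḡ b` and `(f, g)_w = f - a g b`. -/
  inclusion : ∀ {X Y A B : C} (f : Poly k X Y) (g : Poly k A B) (f' : X ⟶ Y) (g' : A ⟶ B)
    (b : X ⟶ A) (a : B ⟶ Y), f ∈ @S X Y → g ∈ @S A B →
    IsLeadingWord lt f f' → IsLeadingWord lt g g' → f' = b ≫ g' ≫ a →
    f - mul (word k b) (mul g (word k a)) ∈ trivialMod lt S f'
  /-- Compositions of intersection: `w = f̄ b = a ḡ` and `(f, g)_w = f b - a g`. -/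
  intersection : ∀ {X Y A B : C} (f : Poly k B Y) (g : Poly k X A) (f' : B ⟶ Y) (g' : X ⟶ A)
    (b : X ⟶ B) (a : A ⟶ Y), f ∈ @S B Y → g ∈ @S X A →
    IsLeadingWord lt f f' → IsLeadingWord lt g g' → b ≫ f' = g' ≫ a →
    mul (word k b) f - mul g (word k a) ∈ trivialMod lt S (b ≫ f')

/-- The canonical `k`-linear map `kC → kC(|R)` onto the category partial algebra of the quotient
category of `C` by the congruence generated by `R`. -/
def toQuotient (R : HomRel C) {X Y : C} (f : Poly k X Y) :
    Poly k ((Quotient.functor R).obj X) ((Quotient.functor R).obj Y) :=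
  f.mapDomain (Quotient.functor R).map

end CatAlg

/-! ## The cyclic category -/

namespace Cyc

/-- The vertices `[p]`, `p = 0, 1, 2, ...`, of the graph `Y`. -/
structure Vertex where
  idx : ℕ

/-- The edges of the graph `Y`. -/
inductive Edge : Vertex → Vertex → Type
  /-- `eps p i` is `ε_{p+1}^i : [p] ⟶ [p+1]`, for `0 ≤ i ≤ p + 1`. -/
  | eps (p i : ℕ) (h : i ≤ p + 1) : Edge ⟨p⟩ ⟨p + 1⟩
  /-- `eta q j` is `η_q^j : [q+1] ⟶ [q]`, for `0 ≤ j ≤ q`. -/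
  | eta (q j : ℕ) (h : j ≤ q) : Edge ⟨q + 1⟩ ⟨q⟩
  /-- `t_q : [q] ⟶ [q]`. -/
  | t (q : ℕ) : Edge ⟨q⟩ ⟨q⟩

instance : Quiver Vertex := ⟨Edge⟩

/-- The free category `C(Y)`. -/
abbrev CY : Type := Paths Vertex

/-- The object `[p]` of `C(Y)`. -/
def obj (p : ℕ) : CY := (Paths.of Vertex).obj ⟨p⟩

/-- `ε_{p+1}^i : [p] ⟶ [p+1]`. -/
def eps (p i : ℕ) (h : i ≤ p + 1) : obj p ⟶ obj (p + 1) :=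
  (Paths.of Vertex).map (Edge.eps p i h : (⟨p⟩ : Vertex) ⟶ ⟨p + 1⟩)

/-- `η_q^j : [q+1] ⟶ [q]`. -/
def eta (q j : ℕ) (h : j ≤ q) : obj (q + 1) ⟶ obj q :=
  (Paths.of Vertex).map (Edge.eta q j h : (⟨q + 1⟩ : Vertex) ⟶ ⟨q⟩)

/-- `t_q : [q] ⟶ [q]`. -/
def t (q : ℕ) : obj q ⟶ obj q :=
  (Paths.of Vertex).map (Edge.t q : (⟨q⟩ : Vertex) ⟶ ⟨q⟩)

/-- `t_q ^ n`. -/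
def tpow (q : ℕ) : ℕ → (obj q ⟶ obj q)
  | 0 => 𝟙 (obj q)
  | n + 1 => tpow q n ≫ t q

/-- The defining relations `S` of the cyclic category. Here `u ≫ v` is the word `v u`. -/
inductive S : HomRel CY
  /-- `ε_{q+1}^i ε_q^{j-1} = ε_{q+1}^j ε_q^i` for `j > i`;
  below, `q` stands for `q - 1` and `j` for `j - 1`. -/
  | f (q i j : ℕ) (hij : i ≤ j) (hj : j ≤ q + 1) :
    S (eps q j (by omega) ≫ eps (q + 1) i (by omega))
      (eps q i (by omega) ≫ eps (q + 1) (j + 1) (by omega))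
  /-- `η_q^j η_{q+1}^i = η_q^i η_{q+1}^{j+1}` for `j ≥ i`. -/
  | g (q i j : ℕ) (hij : i ≤ j) (hj : j ≤ q) :
    S (eta (q + 1) i (by omega) ≫ eta q j (by omega))
      (eta (q + 1) (j + 1) (by omega) ≫ eta q i (by omega))
  /-- `η_{q-1}^j ε_q^i = ε_{q-1}^i η_{q-2}^{j-1}` for `j > i`;
  below, `q` stands for `q - 2` and `j` for `j - 1`. -/
  | h_lt (q i j : ℕ) (hij : i ≤ j) (hj : j ≤ q) :
    S (eps (q + 1) i (by omega) ≫ eta (q + 1) (j + 1) (by omega))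
      (eta q j (by omega) ≫ eps q i (by omega))
  /-- `η_{q-1}^j ε_q^i = 1_{q-1}` for `i = j`; below, `q` stands for `q - 1`. -/
  | h_eq (q j : ℕ) (hj : j ≤ q) :
    S (eps q j (by omega) ≫ eta q j (by omega)) (𝟙 (obj q))
  /-- `η_{q-1}^j ε_q^i = 1_{q-1}` for `i = j + 1`; below, `q` stands for `q - 1`. -/
  | h_succ (q j : ℕ) (hj : j ≤ q) :
    S (eps q (j + 1) (by omega) ≫ eta q j (by omega)) (𝟙 (obj q))
  /-- `η_{q-1}^j ε_q^i = ε_{q-1}^{i-1} η_{q-2}^j` for `i > j + 1`;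
  below, `q` stands for `q - 2` and `i` for `i - 1`. -/
  | h_gt (q i j : ℕ) (hij : j < i) (hi : i ≤ q + 1) :
    S (eps (q + 1) (i + 1) (by omega) ≫ eta (q + 1) j (by omega))
      (eta q j (by omega) ≫ eps q i (by omega))
  /-- `t_q ε_q^i = ε_q^{i-1} t_{q-1}` for `1 ≤ i ≤ q`;
  below, `q` stands for `q - 1` and `i` for `i - 1`. -/
  | rho1 (q i : ℕ) (hi : i ≤ q) :
    S (eps q (i + 1) (by omega) ≫ t (q + 1)) (t q ≫ eps q i (by omega))
  /-- `t_q η_q^i = η_q^{i-1} t_{q+1}` for `1 ≤ i ≤ q`; below, `i` stands for `i - 1`. -/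
  | rho2 (q i : ℕ) (hi : i + 1 ≤ q) :
    S (eta q (i + 1) hi ≫ t q) (t (q + 1) ≫ eta q i (by omega))
  /-- `t_q^{q+1} = 1_q`. -/
  | rho3 (q : ℕ) : S (tpow q (q + 1)) (𝟙 (obj q))

/-- The relations `ρ₄` and `ρ₅`. -/
inductive Rho45 : HomRel CY
  /-- `t_q ε_q^0 = ε_q^q` for `q ≥ 1`; below, `q` stands for `q - 1`. -/
  | rho4 (q : ℕ) : Rho45 (eps q 0 (by omega) ≫ t (q + 1)) (eps q (q + 1) le_rfl)
  /-- `t_q η_q^0 = η_q^q t_{q+1}^2`. -/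
  | rho5 (q : ℕ) : Rho45 (eta q 0 (by omega) ≫ t q) (tpow (q + 1) 2 ≫ eta q q le_rfl)

/-- `S^C = S ∪ {ρ₄, ρ₅}`. -/
def SC : HomRel CY := fun _ _ u v => S u v ∨ Rho45 u v

/-- The cyclic category `Λ = C(Y | S)`. -/
abbrev Lam : Type := Quotient S

/-- The canonical functor `C(Y) ⥤ Λ`. -/
abbrev toLam : CY ⥤ Lam := Quotient.functor S

/-! ### The order `≻₂` -/

/-- A power `t_p ^ i`, recorded as `(i, p)`; the empty word `1_p` is `(0, p)`. -/
abbrev TWord : Type := ℕ × ℕ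

/-- The letter `η_p^i` or `ε_p^i`, recorded as `(p, i)`. -/
abbrev Idx : Type := ℕ × ℕ

/-- A word `w₀ η w₁ η ... η wₙ`, recorded as `(w₀, [(η, w₁), ..., (η, wₙ)])`. -/
abbrev EtaWord : Type := TWord × List (Idx × TWord)

/-- A word `v₀ ε v₁ ε ... ε vₙ`, recorded as `(v₀, [(ε, v₁), ..., (ε, vₙ)])`. -/
abbrev EpsWord : Type := EtaWord × List (Idx × EtaWord)

/-- Multiply by one letter on the left (this is composition with an edge after the word). -/
def consLetter {a b : Vertex} (e : Edge a b) (u : EpsWord) : EpsWord :=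
  match e with
  | Edge.eps p i _ => ((((0, p + 1), []) : EtaWord), ((p + 1, i), u.1) :: u.2)
  | Edge.eta q j _ => (((0, q), ((q, j), u.1.1) :: u.1.2), u.2)
  | Edge.t _ => (((u.1.1.1 + 1, u.1.1.2), u.1.2), u.2)

/-- The decomposition `u = v₀ ε v₁ ε ... ε vₙ` of a path, with every `v_j` decomposed as
`w₀ η w₁ η ... η w_m`. -/
def decomp {a : Vertex} : {b : Vertex} → Quiver.Path a b → EpsWord
  | _, Quiver.Path.nil => (((0, a.idx), []), [])
  | _, Quiver.Path.cons u e => consLetter e (decomp u)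

/-- `(n, w₀, ..., wₙ, η_{p_n}^{i_n}, ..., η_{p_1}^{i_1})`. -/
abbrev EtaWt : Type := ℕ × List TWord × List Idx

def EtaWord.wt (v : EtaWord) : EtaWt :=
  (v.2.length, v.1 :: v.2.map Prod.snd, (v.2.map Prod.fst).reverse)

/-- `(n, v₀, ..., vₙ, ε_{p_1}^{i_1}, ..., ε_{p_n}^{i_n})`. -/
abbrev EpsWt : Type := ℕ × List EtaWt × List Idx

def EpsWord.wt (u : EpsWord) : EpsWt :=
  (u.2.length, EtaWord.wt u.1 :: u.2.map (fun x => EtaWord.wt x.2), u.2.map Prod.fst)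

/-- `t_p^i < t_q^j` iff `i < j`, or `i = j` and `p < q`. -/
def TLt : TWord → TWord → Prop := Prod.Lex (· < ·) (· < ·)

/-- `η_p^i < η_q^j` (and `ε_p^i < ε_q^j`) iff `p < q`, or `p = q` and `i > j`. -/
def IdxLt : Idx → Idx → Prop := Prod.Lex (· < ·) (· > ·)

def EtaWtLt : EtaWt → EtaWt → Prop :=
  Prod.Lex (· < ·) (Prod.Lex (List.Lex TLt) (List.Lex IdxLt))

def EpsWtLt : EpsWt → EpsWt → Prop :=
  Prod.Lex (· < ·) (Prod.Lex (List.Lex EtaWtLt) (List.Lex IdxLt))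

/-- The order on `C(Y)`: `lt₂ u v` means `v ≻₂ u`. -/
def lt₂ (u v : Arrow CY) : Prop :=
  EpsWtLt (EpsWord.wt (decomp u.hom)) (EpsWord.wt (decomp v.hom))

/-! ### Normal forms -/

inductive Letter
  /-- `eps p i` is `ε_p^i`. -/
  | eps (p i : ℕ)
  /-- `eta q j` is `η_q^j`. -/
  | eta (q j : ℕ)
  /-- `t q` is `t_q`. -/
  | t (q : ℕ)

def Edge.letter : {a b : Vertex} → Edge a b → Letter
  | _, _, Edge.eps p i _ => Letter.eps (p + 1) i
  | _, _, Edge.eta q j _ => Letter.eta q j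
  | _, _, Edge.t q => Letter.t q

/-- The letters of a path, from left to right (so the edge that is composed last comes first). -/
def letters {a : Vertex} : {b : Vertex} → Quiver.Path a b → List Letter
  | _, Quiver.Path.nil => []
  | _, Quiver.Path.cons u e => Edge.letter e :: letters u

/-- The data of a normal form `[q] ⟶ [p]`: lists `i₁ > ... > i_m` and `j₁ < ... < j_n`
and a number `e`, with `p ≥ i₁`, `j_n < q`, `0 ≤ e ≤ q` and `q - n + m = p`. -/
@[ext]
structure NormalForm (q p : ℕ) where
  is : List ℕ
  js : List ℕ
  e : ℕ
  is_decreasing : is.Pairwise (· > ·)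
  is_le : ∀ i ∈ is, i ≤ p
  js_increasing : js.Pairwise (· < ·)
  js_lt : ∀ j ∈ js, j < q
  e_le : e ≤ q
  length_eq : q + is.length = p + js.length

/-- The word `ε_p^{i₁} ... ε_{p-m+1}^{i_m} η_{q-n}^{j₁} ... η_{q-1}^{j_n} t_q^e`. -/
def NormalForm.word {q p : ℕ} (N : NormalForm q p) : List Letter :=
  N.is.mapIdx (fun a i => Letter.eps (p - a) i) ++
    N.js.mapIdx (fun b j => Letter.eta (q - N.js.length + b) j) ++
    List.replicate N.e (Letter.t q)

/-- The morphism `μ` of `Λ` is represented by the word of the normal form `N`. -/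
def NormalForm.Represents {q p : ℕ} (N : NormalForm q p)
    (μ : toLam.obj (obj q) ⟶ toLam.obj (obj p)) : Prop :=
  ∃ u : obj q ⟶ obj p, letters u = N.word ∧ toLam.map u = μ

end Cyc

end

open CategoryTheory

noncomputable section

/-! ### Ideals generated by binomials and the kernel of the map to the quotient category. -/

namespace CatAlg

universe w v u

variable {k : Type w} [Field k] {C : Type u} [Category.{v} C]

/-! The compositions of `S^C` are not examined one by one. Each composition of two binomials is a
difference of two congruent words, both smaller than `w`. If every irreducible word lies in a family
of pairwise incongruent words, then both words reduce to the same member of the family by steps that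
stay below `w`, and the composition is trivial (`isGroebnerShirshovBasis_polys`). This needs a
monomial order, relations whose larger side is on the left, and such a family.

The order is read off from weights. The leading number of a weight fixes the lengths of its lists,
and indices are bounded by levels, so it is well-founded. Multiplication by one letter changes two
weights in the same way at the same place, so it is monotone (`consWt_lt`, `snocWt_lt`).

The family consists of the normal forms. A letter put in front of a normal word gives a normal word
or creates the left side of a relation (`normal_or_reducible`). Incongruence comes from a
representation: letters act on `ℤ` as quasi-periodic maps, namely cofaces, codegeneracies and the
translation by `-1`. Every relation holds up to translation by a multiple of the period
(`evalPath_SC`). The map of a normal form, even up to such a translation, determines the form: the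
rotation gives `e`, the missed values give the `ε` indices, and the places where the map is constant
give the `η` indices (`NormalForm.eq_of_evalWord`).

Finally `ρ₄` and `ρ₅` follow from `S` (`toLam_map_eq_of_rho45`), so both sets generate the same
ideal and the normal forms also classify the morphisms of `Λ`. -/

theorem mul_word_word {X Y Z : C} (u : X ⟶ Y) (v : Y ⟶ Z) :
    mul (word k u) (word k v) = word k (u ≫ v) := by
  rw [mul, word, word, Finsupp.sum_single_index (by simp), Finsupp.sum_single_index (by simp),
    mul_one, word]

theorem mul_add {X Y Z : C} (f : Poly k X Y) (g h : Poly k Y Z) :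
    mul f (g + h) = mul f g + mul f h := by
  unfold mul
  rw [← Finsupp.sum_add]
  refine Finsupp.sum_congr fun u _ => ?_
  classical
  rw [Finsupp.sum_add_index (by simp) (by intros; simp [_root_.mul_add])]

theorem add_mul {X Y Z : C} (f g : Poly k X Y) (h : Poly k Y Z) :
    mul (f + g) h = mul f h + mul g h := by
  unfold mul
  classical
  rw [Finsupp.sum_add_index (by simp) (by intros; simp [_root_.add_mul, Finsupp.sum_add])]

theorem mul_sub {X Y Z : C} (f : Poly k X Y) (g h : Poly k Y Z) :
    mul f (g - h) = mul f g - mul f h :=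
  eq_sub_of_add_eq (by rw [← mul_add, sub_add_cancel])

theorem sub_mul {X Y Z : C} (f g : Poly k X Y) (h : Poly k Y Z) :
    mul (f - g) h = mul f h - mul g h :=
  eq_sub_of_add_eq (by rw [← add_mul, sub_add_cancel])

theorem MemIdeal.sum {S : PolySet k C} {X Y : C} {ι : Type*} (s : Finset ι) {f : ι → Poly k X Y}
    (h : ∀ i ∈ s, MemIdeal S (f i)) : MemIdeal S (∑ i ∈ s, f i) := by
  classical
  induction s using Finset.induction_on with
  | empty => simpa using MemIdeal.zero
  | insert a s ha ih =>
    rw [Finset.sum_insert ha]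
    exact (h a (by simp)).add (ih fun i hi => h i (by simp [hi]))

theorem MemIdeal.le {S T : PolySet k C}
    (h : ∀ ⦃X Y : C⦄ (f : Poly k X Y), f ∈ @S X Y → MemIdeal T f)
    {X Y : C} {f : Poly k X Y} (hf : MemIdeal S f) : MemIdeal T f := by
  induction hf with
  | of hs => exact h _ hs
  | zero => exact .zero
  | add _ _ h1 h2 => exact h1.add h2
  | smul c _ h1 => exact h1.smul c
  | mul_left f _ h1 => exact h1.mul_left f
  | mul_right f _ h1 => exact h1.mul_right f

theorem eqvGen_of_map_eq {R : HomRel C} {X Y : C} {u v : X ⟶ Y}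
    (h : (Quotient.functor R).map u = (Quotient.functor R).map v) :
    Relation.EqvGen (@HomRel.CompClosure C _ R X Y) u v :=
  Quot.eqvGen_exact h

/-- Congruent words are joined by a zigzag of elementary replacements; each contributes an element
of the ideal, and the differences telescope. -/
theorem memIdeal_word_sub_word {R : HomRel C} {X Y : C} {u v : X ⟶ Y}
    (h : (Quotient.functor R).map u = (Quotient.functor R).map v) :
    MemIdeal (polys k R) (word k u - word k v) := by
  have h' := eqvGen_of_map_eq h
  clear h
  induction h' with
  | rel x y h =>
    obtain ⟨A, B, f, m₁, m₂, g, hm⟩ := h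
    have : word k (f ≫ m₁ ≫ g) - word k (f ≫ m₂ ≫ g)
        = mul (word k f) (mul (word k m₁ - word k m₂) (word k g)) := by
      simp [sub_mul, mul_sub, mul_word_word]
    rw [this]
    exact .mul_left _ (.mul_right _ (.of ⟨m₁, m₂, hm, rfl⟩))
  | refl x => rw [sub_self]; exact .zero
  | symm x y _ ih => rw [← neg_sub, ← neg_one_smul k]; exact ih.smul _
  | trans x y z _ _ h1 h2 => rw [← sub_add_sub_cancel]; exact h1.add h2

theorem toQuotient_mul {R : HomRel C} {X Y Z : C} (f : Poly k X Y) (g : Poly k Y Z) :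
    toQuotient R (mul f g) = mul (toQuotient R f) (toQuotient R g) := by
  unfold toQuotient mul
  rw [Finsupp.sum_mapDomain_index (by simp) (by intros; simp [_root_.add_mul, Finsupp.sum_add]),
    Finsupp.sum, Finsupp.mapDomain_finsetSum, Finsupp.sum]
  refine Finset.sum_congr rfl fun u _ => ?_
  rw [Finsupp.sum_mapDomain_index (by simp) (by intros; simp [_root_.mul_add]),
    Finsupp.sum, Finsupp.mapDomain_finsetSum, Finsupp.sum]
  refine Finset.sum_congr rfl fun v _ => ?_
  rw [Finsupp.mapDomain_single, Functor.map_comp]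

theorem toQuotient_eq_zero_of_memIdeal {R : HomRel C} {X Y : C} {f : Poly k X Y}
    (hf : MemIdeal (polys k R) f) : toQuotient R f = 0 := by
  induction hf with
  | of hs =>
    obtain ⟨u, v, h, rfl⟩ := hs
    have := CategoryTheory.Quotient.sound R h
    simp only [toQuotient, word, sub_eq_add_neg, Finsupp.mapDomain_add, ← Finsupp.single_neg,
      Finsupp.mapDomain_single, this]
    simp
  | zero => exact Finsupp.mapDomain_zero
  | add _ _ h1 h2 =>
    unfold toQuotient at *
    rw [Finsupp.mapDomain_add, h1, h2, add_zero]
  | smul c _ h1 =>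
    unfold toQuotient at *
    rw [Finsupp.mapDomain_smul, h1, smul_zero]
  | mul_left f _ h1 => rw [toQuotient_mul, h1]; simp [mul]
  | mul_right f _ h1 => rw [toQuotient_mul, h1]; simp [mul]

/-- Choose a representative of each congruence class. Replacing every word of `f` by its
representative changes `f` by an element of the ideal, and the result is `0` because it depends only
on the image of `f`. -/
theorem memIdeal_of_toQuotient_eq_zero {R : HomRel C} {X Y : C} {f : Poly k X Y}
    (hf : toQuotient R f = 0) : MemIdeal (polys k R) f := by
  obtain ⟨s, hs⟩ := ((Quotient.functor R).map_surjective (X := X) (Y := Y)).hasRightInverse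
  have h0 : f.mapDomain (s ∘ (Quotient.functor R).map) = 0 := by
    rw [Finsupp.mapDomain_comp]
    change Finsupp.mapDomain s (toQuotient R f) = 0
    rw [hf, Finsupp.mapDomain_zero]
  have h1 : f = ∑ u ∈ f.support, f u • (word k u - word k (s ((Quotient.functor R).map u))) := by
    simp only [smul_sub, Finset.sum_sub_distrib]
    have e1 : ∑ u ∈ f.support, f u • word k u = f := by
      conv_rhs => rw [← Finsupp.sum_single f]
      simp [word, Finsupp.sum]
    have e2 : ∑ u ∈ f.support, f u • word k (s ((Quotient.functor R).map u)) = 0 := by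
      rw [← h0]
      simp [word, Finsupp.mapDomain, Finsupp.sum]
    rw [e1, e2, sub_zero]
  rw [h1]
  exact .sum _ fun u _ => .smul _ (memIdeal_word_sub_word (hs _).symm)

theorem memIdeal_iff_toQuotient_eq_zero (R : HomRel C) {X Y : C} (f : Poly k X Y) :
    MemIdeal (polys k R) f ↔ toQuotient R f = 0 :=
  ⟨toQuotient_eq_zero_of_memIdeal, memIdeal_of_toQuotient_eq_zero⟩

/-! ### A criterion for Groebner-Shirshov bases made of binomials. -/

section Order

variable {lt : Arrow C → Arrow C → Prop}

theorem isLeadingWord_word_sub_word [Std.Irrefl lt] {X Y : C} {u v : X ⟶ Y}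
    (h : lt (Arrow.mk v) (Arrow.mk u)) :
    IsLeadingWord lt (word k u - word k v) u ∧ (word k u - word k v) u = 1 := by
  have hne : u ≠ v := by rintro rfl; exact irrefl_of lt _ h
  have h1 : (word k u - word k v) u = 1 := by simp [word, hne.symm]
  refine ⟨⟨by simp [h1], fun x hx hxu => ?_⟩, h1⟩
  obtain rfl : x = v := by
    by_contra hxv
    exact hx (by simp [word, Ne.symm hxu, Ne.symm hxv])
  exact h

theorem IsLeadingWord.unique [Std.Asymm lt] {X Y : C} {f : Poly k X Y} {u v : X ⟶ Y}
    (hu : IsLeadingWord lt f u) (hv : IsLeadingWord lt f v) : u = v := by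
  by_contra h
  exact asymm_of lt (hu.2 v hv.1 (Ne.symm h)) (hv.2 u hu.1 h)

variable (lt) in
/-- Every relation of `R` has its larger side on the left. -/
def Oriented (R : HomRel C) : Prop :=
  ∀ ⦃X Y : C⦄ (u v : X ⟶ Y), R u v → lt (Arrow.mk v) (Arrow.mk u)

variable (lt) in
/-- `P` is a family of normal words for `R`: words outside `P` contain the larger side of a relation
of `R`, and no two normal words are congruent. -/
structure IsNormalFamily (R : HomRel C) (P : ∀ ⦃X Y : C⦄, (X ⟶ Y) → Prop) : Prop where
  reducible : ∀ ⦃X Y : C⦄ (u : X ⟶ Y), P u ∨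
    ∃ (A B : C) (b : X ⟶ A) (s s' : A ⟶ B) (a : B ⟶ Y), R s s' ∧ u = b ≫ s ≫ a
  unique : ∀ ⦃X Y : C⦄ (u v : X ⟶ Y), P u → P v →
    (Quotient.functor R).map u = (Quotient.functor R).map v → u = v

variable {R : HomRel C} {P : ∀ ⦃X Y : C⦄, (X ⟶ Y) → Prop}

theorem IsMonomialOrder.comp_lt (hlt : IsMonomialOrder lt) {X A B Y : C} (b : X ⟶ A)
    {s s' : A ⟶ B} (a : B ⟶ Y) (h : lt (Arrow.mk s') (Arrow.mk s)) :
    lt (Arrow.mk (b ≫ s' ≫ a)) (Arrow.mk (b ≫ s ≫ a)) :=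
  hlt.comp_pre _ _ _ (hlt.comp_post _ _ _ h)

/-- Rewriting a larger side into the smaller one lowers the word, so well-founded induction applies.
Each step subtracts an `S`-word whose leading word is the current word, hence below `w`. The word
`n` is chosen before `w`, so it does not depend on the bound. -/
theorem exists_normal_sub_mem_trivialMod (hlt : IsMonomialOrder lt) (hR : Oriented lt R)
    (hP : IsNormalFamily R P) (k : Type w) [Field k] {X Y : C} (u : X ⟶ Y) :
    ∃ n : X ⟶ Y, P n ∧ (Quotient.functor R).map u = (Quotient.functor R).map n ∧
      ∀ w : X ⟶ Y, lt (Arrow.mk u) (Arrow.mk w) →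
        word k u - word k n ∈ trivialMod lt (polys k R) w := by
  have := hlt.wellOrder
  obtain ⟨x, hx⟩ : ∃ x, x = Arrow.mk u := ⟨_, rfl⟩
  induction x using (IsWellFounded.wf (r := lt)).induction generalizing u with
  | _ x ih =>
    subst hx
    rcases hP.reducible u with h | ⟨A, B, b, s, s', a, hs, rfl⟩
    · exact ⟨u, h, rfl, fun w _ => by rw [sub_self]; exact Submodule.zero_mem _⟩
    · have hlt' := hlt.comp_lt b a (hR _ _ hs)
      obtain ⟨n, hn, he, hn'⟩ := ih _ hlt' _ rfl
      refine ⟨n, hn, ?_, fun w hw => ?_⟩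
      · rw [← he]
        simp only [Functor.map_comp, CategoryTheory.Quotient.sound R hs]
      · rw [← sub_add_sub_cancel _ (word k (b ≫ s' ≫ a))]
        refine Submodule.add_mem _ (Submodule.subset_span ?_) (hn' w (trans_of lt hlt' hw))
        exact ⟨A, B, word k s - word k s', s, b, a, ⟨s, s', hs, rfl⟩,
          (isLeadingWord_word_sub_word (hR _ _ hs)).1, hw, by
          simp [sub_mul, mul_sub, mul_word_word]⟩

theorem sub_mem_trivialMod (hlt : IsMonomialOrder lt) (hR : Oriented lt R)
    (hP : IsNormalFamily R P) {X Y : C} {u v w : X ⟶ Y}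
    (h : (Quotient.functor R).map u = (Quotient.functor R).map v)
    (hu : lt (Arrow.mk u) (Arrow.mk w)) (hv : lt (Arrow.mk v) (Arrow.mk w)) :
    word k u - word k v ∈ trivialMod lt (polys k R) w := by
  obtain ⟨n, hn, en, hn'⟩ := exists_normal_sub_mem_trivialMod hlt hR hP k u
  obtain ⟨m, hm, em, hm'⟩ := exists_normal_sub_mem_trivialMod hlt hR hP k v
  obtain rfl := hP.unique _ _ hn hm (by rw [← en, h, em])
  rw [← sub_sub_sub_cancel_right _ _ (word k n)]
  exact Submodule.sub_mem _ (hn' w hu) (hm' w hv)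

/-- Oriented relations with pairwise incongruent normal words form a Groebner-Shirshov basis. -/
theorem isGroebnerShirshovBasis_polys (hlt : IsMonomialOrder lt) (hR : Oriented lt R)
    (hP : IsNormalFamily R P) (hne : ∃ (X Y : C) (u v : X ⟶ Y), R u v) :
    IsGroebnerShirshovBasis lt (polys k R) := by
  have := hlt.wellOrder
  refine ⟨hlt, ?_, ?_, ?_, ?_⟩
  · obtain ⟨X, Y, u, v, h⟩ := hne
    exact ⟨X, Y, _, u, v, h, rfl⟩
  · rintro X Y _ ⟨u, v, h, rfl⟩
    exact ⟨u, isLeadingWord_word_sub_word (hR _ _ h)⟩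
  · rintro X Y A B _ _ f' g' b a ⟨u, v, h, rfl⟩ ⟨u₂, v₂, h₂, rfl⟩ hf hg hw
    obtain rfl := hf.unique (isLeadingWord_word_sub_word (hR _ _ h)).1
    obtain rfl := hg.unique (isLeadingWord_word_sub_word (hR _ _ h₂)).1
    -- The two copies of the leading word `f'` cancel, leaving a difference of two smaller words.
    have e : word k f' - word k v - mul (word k b) (mul (word k g' - word k v₂) (word k a))
        = word k (b ≫ v₂ ≫ a) - word k v := by
      simp only [sub_mul, mul_sub, mul_word_word, ← hw]
      abel
    rw [e]
    refine sub_mem_trivialMod hlt hR hP ?_ ?_ (hR _ _ h)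
    · rw [← CategoryTheory.Quotient.sound R h, hw]
      simp only [Functor.map_comp, CategoryTheory.Quotient.sound R h₂]
    · rw [hw]
      exact hlt.comp_lt _ _ (hR _ _ h₂)
  · rintro X Y A B _ _ f' g' b a ⟨u, v, h, rfl⟩ ⟨u₂, v₂, h₂, rfl⟩ hf hg hw
    obtain rfl := hf.unique (isLeadingWord_word_sub_word (hR _ _ h)).1
    obtain rfl := hg.unique (isLeadingWord_word_sub_word (hR _ _ h₂)).1
    have e : mul (word k b) (word k f' - word k v) - mul (word k g' - word k v₂) (word k a)
        = word k (v₂ ≫ a) - word k (b ≫ v) := by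
      simp only [sub_mul, mul_sub, mul_word_word, hw]
      abel
    rw [e]
    refine sub_mem_trivialMod hlt hR hP ?_ ?_ (hlt.comp_pre _ _ _ (hR _ _ h))
    · rw [Functor.map_comp, Functor.map_comp, ← CategoryTheory.Quotient.sound R h₂,
        ← CategoryTheory.Quotient.sound R h, ← Functor.map_comp, ← Functor.map_comp, hw]
    · rw [hw]
      exact hlt.comp_post _ _ _ (hR _ _ h₂)

end Order

end CatAlg

/-! ### Lexicographic comparison of lists under changes at either end. -/

namespace List

variable {α : Type*} {r : α → α → Prop}

/-- Equal lengths exclude a proper prefix, the one case in which appending could spoil the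
comparison. -/
theorem Lex.append_of_length_eq {l l' : List α} (h : Lex r l l') (hl : l.length = l'.length)
    (m : List α) : Lex r (l ++ m) (l' ++ m) := by
  induction h with
  | nil => simp at hl
  | rel h => exact .rel h
  | cons _ ih => exact .cons (ih (by simpa using hl))

theorem Lex.modifyHead {f : α → α} {l l' : List α} (h : Lex r l l')
    (hf : ∀ a ∈ l, ∀ b ∈ l', r a b → r (f a) (f b)) :
    Lex r (l.modifyHead f) (l'.modifyHead f) := by
  cases h with
  | nil => exact .nil
  | rel h => exact .rel (hf _ (by simp) _ (by simp) h)
  | cons h => exact .cons h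

/-- Apply `f` to the last entry of a list. -/
def mapLast (f : α → α) : List α → List α
  | [] => []
  | [a] => [f a]
  | a :: b :: l => a :: mapLast f (b :: l)

@[simp] theorem mapLast_singleton (f : α → α) (a : α) : mapLast f [a] = [f a] := rfl

@[simp] theorem mapLast_cons_cons (f : α → α) (a b : α) (l : List α) :
    mapLast f (a :: b :: l) = a :: mapLast f (b :: l) := rfl

@[simp] theorem length_mapLast (f : α → α) : ∀ l : List α, (mapLast f l).length = l.length
  | [] => rfl
  | [_] => rfl
  | _ :: b :: l => by simp [length_mapLast f (b :: l)]

theorem Lex.mapLast {f : α → α} : ∀ {l l' : List α}, Lex r l l' → l.length = l'.length →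
    (∀ a ∈ l, ∀ b ∈ l', r a b → r (f a) (f b)) → Lex r (mapLast f l) (mapLast f l')
  | _, _, .nil, hl, _ => by simp at hl
  | [a], [b], .rel h, _, hf => .rel (hf a (by simp) b (by simp) h)
  | [a], _ :: _ :: _, _, hl, _ => by simp at hl
  | _ :: _ :: _, [a], _, hl, _ => by simp at hl
  | [_], [_], .cons h, _, _ => by cases h
  | a :: b :: l, c :: d :: l', .rel h, _, _ => .rel h
  | a :: b :: l, _ :: d :: l', .cons h, hl, hf =>
    .cons (h.mapLast (by simpa using hl) fun x hx y hy =>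
      hf x (mem_cons_of_mem _ hx) y (mem_cons_of_mem _ hy))

theorem Lex.imp_of_mem {s : α → α → Prop} {l l' : List α} (h : Lex r l l')
    (H : ∀ a ∈ l, ∀ b ∈ l', r a b → s a b) : Lex s l l' := by
  induction h with
  | nil => exact .nil
  | rel h => exact .rel (H _ (by simp) _ (by simp) h)
  | cons _ ih => exact .cons (ih fun a ha b hb => H a (by simp [ha]) b (by simp [hb]))

end List

namespace Cyc

/-! ### Well-foundedness of the lexicographic order on weights. -/

section Weights

variable {α β : Type*} (r : α → α → Prop) (s : β → β → Prop) (P : α → Prop) (Q : β → Prop)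

/-- The lexicographic order on weights `(n, v₀, ..., vₙ, x₁, ..., xₙ)`. -/
def WtLt : ℕ × List α × List β → ℕ × List α × List β → Prop :=
  Prod.Lex (· < ·) (Prod.Lex (List.Lex r) (List.Lex s))

/-- The triples that have the shape of a weight, with entries in `P` and `Q`. -/
structure IsWt (w : ℕ × List α × List β) : Prop where
  length_left : w.2.1.length = w.1 + 1
  length_right : w.2.2.length = w.1
  left : ∀ a ∈ w.2.1, P a
  right : ∀ b ∈ w.2.2, Q b

variable {r s P Q}

theorem wtLt_iff {n n' : ℕ} {l l' : List α} {m m' : List β} :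
    WtLt r s (n, l, m) (n', l', m') ↔
      n < n' ∨ n = n' ∧ (List.Lex r l l' ∨ l = l' ∧ List.Lex s m m') := by
  simp [WtLt, Prod.lex_def]

/-- Plain lexicographic order on lists is not well-founded in general. In a weight the number `n`
fixes both lengths, so the comparison becomes one of length-first (shortlex) orders. -/
theorem wellFounded_wtLt (hr : WellFounded fun a b => r a b ∧ P a ∧ P b)
    (hs : WellFounded fun a b => s a b ∧ Q a ∧ Q b) :
    WellFounded fun a b => WtLt r s a b ∧ IsWt P Q a ∧ IsWt P Q b := by
  -- The number `n` can be dropped: the length `n + 1` of the first list carries it.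
  refine Subrelation.wf ?_ (InvImage.wf Prod.snd
    (WellFounded.prod_lex (List.Shortlex.wf hr) (List.Shortlex.wf hs)))
  rintro ⟨n, l, m⟩ ⟨n', l', m'⟩ ⟨h, h1, h2⟩
  have e1 := h1.length_left
  have e2 := h2.length_left
  have e3 := h1.length_right
  have e4 := h2.length_right
  dsimp only at e1 e2 e3 e4
  rw [wtLt_iff] at h
  rcases h with h | ⟨rfl, h | ⟨rfl, h⟩⟩
  · exact Prod.Lex.left _ _ (.of_length_lt (by omega))
  · exact Prod.Lex.left _ _ (.of_lex (by omega)
      (h.imp_of_mem fun a ha b hb hab => ⟨hab, h1.left a ha, h2.left b hb⟩))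
  · exact Prod.Lex.right _ (.of_lex (by omega)
      (h.imp_of_mem fun a ha b hb hab => ⟨hab, h1.right a ha, h2.right b hb⟩))

instance [Std.Trichotomous r] [Std.Trichotomous s] : Std.Trichotomous (WtLt r s) := by
  unfold WtLt
  infer_instance

end Weights

/-- The index of a letter does not exceed its level. -/
def IdxOk (x : Idx) : Prop := x.2 ≤ x.1

/-- At a fixed level the larger index is the smaller letter, so descent would be infinite without
the bound `i ≤ p`; with it, `(p, p - i)` descends in `ℕ × ℕ`. -/
theorem wellFounded_idxLt : WellFounded fun a b => IdxLt a b ∧ IdxOk a ∧ IdxOk b := by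
  refine Subrelation.wf ?_ (InvImage.wf (fun x : Idx => (x.1, x.1 - x.2))
    (WellFounded.prod_lex (wellFounded_lt (α := ℕ)) (wellFounded_lt (α := ℕ))))
  rintro ⟨p, i⟩ ⟨q, j⟩ ⟨h, h1, h2⟩
  simp only [IdxLt, Prod.lex_def, IdxOk] at h h1 h2
  simp only [InvImage, Prod.lex_def]
  omega

theorem wellFounded_tLt : WellFounded fun a b => TLt a b ∧ True ∧ True := by
  simp only [and_self, and_true]
  exact WellFounded.prod_lex (wellFounded_lt (α := ℕ)) (wellFounded_lt (α := ℕ))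

/-- The triples that have the shape of the weight of a word without `ε`. -/
abbrev EtaWtOk : EtaWt → Prop := IsWt (fun _ : TWord => True) IdxOk

/-- The triples that have the shape of the weight of a word. -/
abbrev EpsWtOk : EpsWt → Prop := IsWt EtaWtOk IdxOk

theorem etaWtLt_eq : EtaWtLt = WtLt TLt IdxLt := rfl

theorem epsWtLt_eq : EpsWtLt = WtLt EtaWtLt IdxLt := rfl

theorem wellFounded_epsWtLt : WellFounded fun a b => EpsWtLt a b ∧ EpsWtOk a ∧ EpsWtOk b :=
  wellFounded_wtLt (wellFounded_wtLt wellFounded_tLt wellFounded_idxLt) wellFounded_idxLt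

instance : Std.Trichotomous TLt := by
  unfold TLt
  infer_instance

instance : Std.Trichotomous IdxLt := by
  unfold IdxLt
  infer_instance

instance : Std.Trichotomous EpsWtLt := by
  rw [epsWtLt_eq, etaWtLt_eq]
  infer_instance

/-! ### Multiplication by a letter, on the level of weights -/

/-- The weight of `t v`. -/
def EtaWt.consT (v : EtaWt) : EtaWt := (v.1, v.2.1.modifyHead fun w => (w.1 + 1, w.2), v.2.2)

/-- The weight of `η_q^j v`. -/
def EtaWt.consEta (q j : ℕ) (v : EtaWt) : EtaWt :=
  (v.1 + 1, (0, q) :: v.2.1, v.2.2 ++ [(q, j)])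

/-- The weight of `v t`. -/
def EtaWt.snocT (v : EtaWt) : EtaWt := (v.1, v.2.1.mapLast fun w => (w.1 + 1, w.2), v.2.2)

/-- The weight of `v η_q^j`. -/
def EtaWt.snocEta (q j : ℕ) (v : EtaWt) : EtaWt :=
  (v.1 + 1, v.2.1 ++ [(0, q + 1)], (q, j) :: v.2.2)

/-- The weight of the empty word at `[p]`. -/
def EtaWt.nil (p : ℕ) : EtaWt := (0, [(0, p)], [])

/-- The weight of `e u` in terms of the weight of `u`. -/
def consWt {a b : Vertex} (e : Edge a b) (u : EpsWt) : EpsWt :=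
  match e with
  | .eps p i _ => (u.1 + 1, EtaWt.nil (p + 1) :: u.2.1, (p + 1, i) :: u.2.2)
  | .eta q j _ => (u.1, u.2.1.modifyHead (EtaWt.consEta q j), u.2.2)
  | .t _ => (u.1, u.2.1.modifyHead EtaWt.consT, u.2.2)

/-- The weight of `u e` in terms of the weight of `u`. -/
def snocWt {a b : Vertex} (e : Edge a b) (u : EpsWt) : EpsWt :=
  match e with
  | .eps p i _ => (u.1 + 1, u.2.1 ++ [EtaWt.nil p], u.2.2 ++ [(p + 1, i)])
  | .eta q j _ => (u.1, u.2.1.mapLast (EtaWt.snocEta q j), u.2.2)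
  | .t _ => (u.1, u.2.1.mapLast EtaWt.snocT, u.2.2)

theorem wt_consLetter {a b : Vertex} (e : Edge a b) (u : EpsWord) :
    EpsWord.wt (consLetter e u) = consWt e (EpsWord.wt u) := by
  obtain ⟨⟨w, l⟩, L⟩ := u
  cases e <;> simp [consLetter, consWt, EpsWord.wt, EtaWord.wt, EtaWt.nil, EtaWt.consEta,
    EtaWt.consT]

/-- The two operations act at opposite ends and can meet only when a list of blocks has a single
entry, whence the case distinctions. On triples with an empty list of blocks they need not commute,
so `u` is a genuine decomposition. -/
theorem consWt_snocWt {a b c d : Vertex} (e : Edge a b) (e' : Edge c d) (u : EpsWord) :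
    consWt e (snocWt e' (EpsWord.wt u)) = snocWt e' (consWt e (EpsWord.wt u)) := by
  obtain ⟨⟨w, l⟩, L⟩ := u
  cases e <;> cases e' <;> rcases L with _ | ⟨x, L⟩ <;> rcases l with _ | ⟨y, l⟩ <;>
    simp [snocWt, consWt, EpsWord.wt, EtaWord.wt, EtaWt.nil, EtaWt.consEta,
      EtaWt.consT, EtaWt.snocT, EtaWt.snocEta]

/-- `decomp` recurses on the edge applied last; an edge applied first has to be carried through all
the others. -/
theorem wt_decomp_toPath_comp {a b c : Vertex} (e : a ⟶ b) (u : Quiver.Path b c) :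
    EpsWord.wt (decomp (e.toPath.comp u)) = snocWt e (EpsWord.wt (decomp u)) := by
  induction u with
  | nil =>
    change Edge a b at e
    cases e <;> simp [Quiver.Hom.toPath, decomp, consLetter, snocWt, EpsWord.wt, EtaWord.wt,
      EtaWt.nil, EtaWt.snocT, EtaWt.snocEta]
  | cons u e' ih =>
    rw [Quiver.Path.comp_cons, decomp, wt_consLetter, ih, decomp, wt_consLetter, consWt_snocWt]

theorem etaWtOk_nil (p : ℕ) : EtaWtOk (EtaWt.nil p) := ⟨by simp [EtaWt.nil], rfl, by simp, by
  simp [EtaWt.nil]⟩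

theorem EtaWtOk.consT {v : EtaWt} (h : EtaWtOk v) : EtaWtOk v.consT :=
  ⟨by simp [EtaWt.consT, h.length_left], h.length_right, by simp, h.right⟩

theorem EtaWtOk.consEta {v : EtaWt} (h : EtaWtOk v) {q j : ℕ} (hj : j ≤ q) :
    EtaWtOk (v.consEta q j) :=
  ⟨by simp [EtaWt.consEta, h.length_left], by simp [EtaWt.consEta, h.length_right], by simp, by
    intro x hx
    simp only [EtaWt.consEta, List.mem_append, List.mem_singleton] at hx
    rcases hx with hx | rfl
    exacts [h.right _ hx, hj]⟩

theorem forall_mem_modifyHead {α : Type*} {p : α → Prop} {f : α → α} {l : List α}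
    (h : ∀ a ∈ l, p a) (hf : ∀ a, p a → p (f a)) : ∀ a ∈ l.modifyHead f, p a := by
  cases l with
  | nil => simp
  | cons a l =>
    simp only [List.mem_cons, forall_eq_or_imp, List.modifyHead_cons] at h ⊢
    exact ⟨hf _ h.1, h.2⟩

theorem EpsWtOk.consWt {u : EpsWt} (h : EpsWtOk u) {a b : Vertex} (e : Edge a b) :
    EpsWtOk (consWt e u) := by
  cases e with
  | eps p i hi =>
    refine ⟨by simp [Cyc.consWt, h.length_left], by simp [Cyc.consWt, h.length_right], ?_, ?_⟩
    · exact List.forall_mem_cons.2 ⟨etaWtOk_nil _, h.left⟩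
    · exact List.forall_mem_cons.2 ⟨hi, h.right⟩
  | eta q j hj =>
    exact ⟨by simp [Cyc.consWt, h.length_left], h.length_right,
      forall_mem_modifyHead h.left fun v hv => hv.consEta hj, h.right⟩
  | t q =>
    exact ⟨by simp [Cyc.consWt, h.length_left], h.length_right,
      forall_mem_modifyHead h.left fun v hv => hv.consT, h.right⟩

theorem epsWtOk_decomp {a b : Vertex} (u : Quiver.Path a b) :
    EpsWtOk (EpsWord.wt (decomp u)) := by
  induction u with
  | nil =>
    refine ⟨rfl, rfl, ?_, by simp [decomp, EpsWord.wt]⟩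
    exact List.forall_mem_cons.2 ⟨etaWtOk_nil _, by simp [decomp]⟩
  | cons u e ih =>
    rw [decomp, wt_consLetter]
    exact ih.consWt e

theorem tLt_succ {v w : TWord} (h : TLt v w) : TLt (v.1 + 1, v.2) (w.1 + 1, w.2) := by
  simpa [TLt, Prod.lex_def] using h

theorem EtaWt.consT_lt {v w : EtaWt} (h : EtaWtLt v w) : EtaWtLt v.consT w.consT := by
  obtain ⟨n, l, m⟩ := v
  obtain ⟨n', l', m'⟩ := w
  simp only [etaWtLt_eq, consT, wtLt_iff] at h ⊢
  rcases h with h | ⟨rfl, h | ⟨rfl, h⟩⟩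
  · exact .inl h
  · exact .inr ⟨rfl, .inl (h.modifyHead fun _ _ _ _ => tLt_succ)⟩
  · exact .inr ⟨rfl, .inr ⟨rfl, h⟩⟩

theorem EtaWt.snocT_lt {v w : EtaWt} (hv : EtaWtOk v) (hw : EtaWtOk w) (h : EtaWtLt v w) :
    EtaWtLt v.snocT w.snocT := by
  obtain ⟨n, l, m⟩ := v
  obtain ⟨n', l', m'⟩ := w
  simp only [etaWtLt_eq, snocT, wtLt_iff] at h ⊢
  rcases h with h | ⟨rfl, h | ⟨rfl, h⟩⟩
  · exact .inl h
  · exact .inr ⟨rfl, .inl (h.mapLast (hv.length_left.trans hw.length_left.symm)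
      fun _ _ _ _ => tLt_succ)⟩
  · exact .inr ⟨rfl, .inr ⟨rfl, h⟩⟩

theorem EtaWt.consEta_lt {v w : EtaWt} (hv : EtaWtOk v) (hw : EtaWtOk w) (h : EtaWtLt v w)
    (q j : ℕ) : EtaWtLt (v.consEta q j) (w.consEta q j) := by
  obtain ⟨n, l, m⟩ := v
  obtain ⟨n', l', m'⟩ := w
  simp only [etaWtLt_eq, consEta, wtLt_iff] at h ⊢
  rcases h with h | ⟨rfl, h | ⟨rfl, h⟩⟩
  · exact .inl (by omega)
  · exact .inr ⟨rfl, .inl (.cons h)⟩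
  · exact .inr ⟨rfl, .inr ⟨rfl, h.append_of_length_eq
      (hv.length_right.trans hw.length_right.symm) _⟩⟩

theorem EtaWt.snocEta_lt {v w : EtaWt} (hv : EtaWtOk v) (hw : EtaWtOk w) (h : EtaWtLt v w)
    (q j : ℕ) : EtaWtLt (v.snocEta q j) (w.snocEta q j) := by
  obtain ⟨n, l, m⟩ := v
  obtain ⟨n', l', m'⟩ := w
  simp only [etaWtLt_eq, snocEta, wtLt_iff] at h ⊢
  rcases h with h | ⟨rfl, h | ⟨rfl, h⟩⟩
  · exact .inl (by omega)
  · exact .inr ⟨rfl, .inl (h.append_of_length_eq (hv.length_left.trans hw.length_left.symm) _)⟩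
  · exact .inr ⟨rfl, .inr ⟨rfl, .cons h⟩⟩

/-- The letter adds equal entries to both weights or applies one strictly monotone map to entries in
the same position, so the first difference survives at its own tier. -/
theorem consWt_lt {u v : EpsWt} (hu : EpsWtOk u) (hv : EpsWtOk v) (h : EpsWtLt u v)
    {a b : Vertex} (e : Edge a b) : EpsWtLt (consWt e u) (consWt e v) := by
  obtain ⟨n, l, m⟩ := u
  obtain ⟨n', l', m'⟩ := v
  cases e <;> simp only [epsWtLt_eq, consWt, wtLt_iff] at h ⊢ <;>
    rcases h with h | ⟨rfl, h | ⟨rfl, h⟩⟩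
  · exact .inl (by omega)
  · exact .inr ⟨rfl, .inl (.cons h)⟩
  · exact .inr ⟨rfl, .inr ⟨rfl, .cons h⟩⟩
  · exact .inl h
  · exact .inr ⟨rfl, .inl (h.modifyHead fun x hx y hy hxy =>
      EtaWt.consEta_lt (hu.left x hx) (hv.left y hy) hxy _ _)⟩
  · exact .inr ⟨rfl, .inr ⟨rfl, h⟩⟩
  · exact .inl h
  · exact .inr ⟨rfl, .inl (h.modifyHead fun x hx y hy hxy => EtaWt.consT_lt hxy)⟩
  · exact .inr ⟨rfl, .inr ⟨rfl, h⟩⟩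

theorem snocWt_lt {u v : EpsWt} (hu : EpsWtOk u) (hv : EpsWtOk v) (h : EpsWtLt u v)
    {a b : Vertex} (e : Edge a b) : EpsWtLt (snocWt e u) (snocWt e v) := by
  obtain ⟨n, l, m⟩ := u
  obtain ⟨n', l', m'⟩ := v
  have hl : n = n' → l.length = l'.length := by
    rintro rfl
    exact hu.length_left.trans hv.length_left.symm
  have hm : n = n' → m.length = m'.length := by
    rintro rfl
    exact hu.length_right.trans hv.length_right.symm
  cases e <;> simp only [epsWtLt_eq, snocWt, wtLt_iff] at h ⊢ <;>
    rcases h with h | ⟨rfl, h | ⟨rfl, h⟩⟩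
  · exact .inl (by omega)
  · exact .inr ⟨rfl, .inl (h.append_of_length_eq (hl rfl) _)⟩
  · exact .inr ⟨rfl, .inr ⟨rfl, h.append_of_length_eq (hm rfl) _⟩⟩
  · exact .inl h
  · exact .inr ⟨rfl, .inl (h.mapLast (hl rfl) fun x hx y hy hxy =>
      EtaWt.snocEta_lt (hu.left x hx) (hv.left y hy) hxy _ _)⟩
  · exact .inr ⟨rfl, .inr ⟨rfl, h⟩⟩
  · exact .inl h
  · exact .inr ⟨rfl, .inl (h.mapLast (hl rfl) fun x hx y hy hxy =>
      EtaWt.snocT_lt (hu.left x hx) (hv.left y hy) hxy)⟩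
  · exact .inr ⟨rfl, .inr ⟨rfl, h⟩⟩

/-! ### Words are determined by their weights -/

theorem map_fst_snd_injective {α β : Type*} :
    ∀ {l l' : List (α × β)}, l.map Prod.fst = l'.map Prod.fst →
      l.map Prod.snd = l'.map Prod.snd → l = l' := by
  intro l l' h1 h2
  rw [← List.zip_unzip l, ← List.zip_unzip l', List.unzip_eq_map, List.unzip_eq_map]
  simp only [h1, h2]

theorem EtaWord.wt_injective : Function.Injective EtaWord.wt := by
  rintro ⟨w, l⟩ ⟨w', l'⟩ h
  simp only [EtaWord.wt, Prod.mk.injEq, List.cons.injEq, List.reverse_inj] at h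
  obtain ⟨-, ⟨rfl, h1⟩, h2⟩ := h
  rw [map_fst_snd_injective h2 h1]

theorem EpsWord.wt_injective : Function.Injective EpsWord.wt := by
  rintro ⟨v, l⟩ ⟨v', l'⟩ h
  simp only [EpsWord.wt, Prod.mk.injEq, List.cons.injEq] at h
  obtain ⟨-, ⟨h0, h1⟩, h2⟩ := h
  obtain rfl := EtaWord.wt_injective h0
  have h1' : (l.map Prod.snd).map EtaWord.wt = (l'.map Prod.snd).map EtaWord.wt := by
    simpa [Function.comp_def] using h1
  rw [map_fst_snd_injective h2 (EtaWord.wt_injective.list_map h1')]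

theorem decomp_target {a b : Vertex} (u : Quiver.Path a b) : (decomp u).1.1.2 = b.idx := by
  induction u with
  | nil => rfl
  | @cons b c u e ih =>
    change Edge b c at e
    cases e <;> simp_all [decomp, consLetter]

/-- The front of the decomposition betrays the last edge: a positive exponent means `t`, otherwise
an `η` in the first block means `η`, otherwise a remaining `ε` means `ε`. Stripping it leaves a
shorter path. The endpoints are part of the conclusion, hence the heterogeneous equality. -/
theorem decomp_injective {a b : Vertex} (u : Quiver.Path a b) :
    ∀ {a' b' : Vertex} (v : Quiver.Path a' b'), decomp u = decomp v →
      a = a' ∧ b = b' ∧ HEq u v := by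
  induction u with
  | nil =>
    intro a' b' v h
    cases v with
    | nil =>
      obtain ⟨x⟩ := a
      obtain ⟨y⟩ := a'
      simp only [decomp, Prod.mk.injEq, true_and, and_true] at h
      subst h
      exact ⟨rfl, rfl, HEq.rfl⟩
    | @cons d _ v e =>
      change Edge d b' at e
      cases e <;> simp [decomp, consLetter] at h
  | @cons b c u e ih =>
    intro a' b' v h
    change Edge b c at e
    cases v with
    | nil => cases e <;> simp [decomp, consLetter] at h
    | @cons d _ v e' =>
      change Edge d b' at e'
      have hu := decomp_target u
      have hv := decomp_target v
      rcases hdu : decomp u with ⟨⟨⟨m, x⟩, l⟩, L⟩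
      rcases hdv : decomp v with ⟨⟨⟨m', x'⟩, l'⟩, L'⟩
      cases e <;> cases e' <;>
        simp only [decomp, consLetter, hdu, hdv, Prod.mk.injEq, List.cons.injEq,
          Nat.add_right_cancel_iff, reduceCtorEq, false_and, and_false, true_and, Nat.add_eq_zero_iff,
          one_ne_zero, Nat.right_eq_add] at h hu hv
      all_goals
        obtain ⟨rfl, hb, huv⟩ := ih v (by rw [hdu, hdv]; simp_all)
        cases hb
        cases huv
      · obtain ⟨-, ⟨⟨-, rfl⟩, -⟩, -⟩ := h
        exact ⟨rfl, rfl, HEq.rfl⟩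
      · obtain ⟨⟨-, ⟨⟨-, rfl⟩, -⟩, -⟩, -⟩ := h
        exact ⟨rfl, rfl, HEq.rfl⟩
      · exact ⟨rfl, rfl, HEq.rfl⟩

theorem wt_decomp_hom_injective :
    Function.Injective fun u : Arrow CY => EpsWord.wt (decomp u.hom) := by
  rintro ⟨a, b, u⟩ ⟨a', b', v⟩ h
  obtain ⟨h1, h2, h3⟩ := decomp_injective u v (EpsWord.wt_injective h)
  change (a : CY) = a' at h1
  change (b : CY) = b' at h2
  subst h1 h2
  obtain rfl := eq_of_heq h3
  rfl

/-! ### The order `≻₂` is a monomial order. -/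

instance isWellOrder_lt₂ : IsWellOrder (Arrow CY) lt₂ where
  wf := by
    refine Subrelation.wf ?_ (InvImage.wf (fun u : Arrow CY => EpsWord.wt (decomp u.hom))
      wellFounded_epsWtLt)
    exact fun h => ⟨h, epsWtOk_decomp _, epsWtOk_decomp _⟩
  toTrichotomous := InvImage.trichotomous (r := EpsWtLt) wt_decomp_hom_injective

theorem lt₂_cons {a a' b c : Vertex} {u : Quiver.Path a b} {v : Quiver.Path a' b}
    (h : EpsWtLt (EpsWord.wt (decomp v)) (EpsWord.wt (decomp u))) (e : b ⟶ c) :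
    EpsWtLt (EpsWord.wt (decomp (v.cons e))) (EpsWord.wt (decomp (u.cons e))) := by
  rw [decomp, wt_consLetter, decomp, wt_consLetter]
  exact consWt_lt (epsWtOk_decomp v) (epsWtOk_decomp u) h e

theorem lt₂_comp {a a' b c : Vertex} {u : Quiver.Path a b} {v : Quiver.Path a' b}
    (h : EpsWtLt (EpsWord.wt (decomp v)) (EpsWord.wt (decomp u))) (w : Quiver.Path b c) :
    EpsWtLt (EpsWord.wt (decomp (v.comp w))) (EpsWord.wt (decomp (u.comp w))) := by
  induction w with
  | nil => exact h
  | cons w e ih => exact lt₂_cons ih e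

theorem lt₂_comp_left {a b c c' : Vertex} (w : Quiver.Path a b) :
    ∀ {u : Quiver.Path b c} {v : Quiver.Path b c'},
      EpsWtLt (EpsWord.wt (decomp v)) (EpsWord.wt (decomp u)) →
      EpsWtLt (EpsWord.wt (decomp (w.comp v))) (EpsWord.wt (decomp (w.comp u))) := by
  induction w with
  | nil =>
    intro u v h
    rwa [Quiver.Path.nil_comp, Quiver.Path.nil_comp]
  | cons w e ih =>
    intro u v h
    rw [← Quiver.Path.comp_toPath_eq_cons, Quiver.Path.comp_assoc, Quiver.Path.comp_assoc]
    apply ih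
    rw [wt_decomp_toPath_comp, wt_decomp_toPath_comp]
    exact snocWt_lt (epsWtOk_decomp v) (epsWtOk_decomp u) h e

theorem isMonomialOrder_lt₂ : CatAlg.IsMonomialOrder (C := CY) lt₂ where
  wellOrder := isWellOrder_lt₂
  comp_post _ _ w h := lt₂_comp h w
  comp_pre w _ _ h := lt₂_comp_left w h

/-! ### Decompositions of the words in the relations, and their larger sides. -/

theorem decomp_tpow (q n : ℕ) : decomp (tpow q n) = (((n, q), []), []) := by
  induction n with
  | zero => rfl
  | succ n ih =>
    change consLetter (Edge.t q) (decomp (tpow q n)) = _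
    rw [ih]
    rfl

theorem decomp_comp_eps {a : CY} {p : ℕ} (u : a ⟶ obj p) (i : ℕ) (h : i ≤ p + 1) :
    decomp (u ≫ eps p i h) = consLetter (Edge.eps p i h) (decomp u) := rfl

theorem decomp_comp_eta {a : CY} {q : ℕ} (u : a ⟶ obj (q + 1)) (j : ℕ) (h : j ≤ q) :
    decomp (u ≫ eta q j h) = consLetter (Edge.eta q j h) (decomp u) := rfl

theorem decomp_comp_t {a : CY} {q : ℕ} (u : a ⟶ obj q) :
    decomp (u ≫ t q) = consLetter (Edge.t q) (decomp u) := rfl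

theorem decomp_eps (p i : ℕ) (h : i ≤ p + 1) :
    decomp (eps p i h) = ((((0, p + 1), []) : EtaWord), [((p + 1, i), ((0, p), []))]) := rfl

theorem decomp_eta (q j : ℕ) (h : j ≤ q) :
    decomp (eta q j h) = (((0, q), [((q, j), (0, q + 1))]), []) := rfl

theorem decomp_t (q : ℕ) : decomp (t q) = (((1, q), []), []) := rfl

theorem decomp_id (q : ℕ) : decomp (𝟙 (obj q)) = (((0, q), []), []) := rfl

/-- Different tiers decide: the number of `ε` for `h` with value `1`; the block before `ε` for the
other `h`, `ρ₁` and `ρ₄`; the power of `t` before `η` for `ρ₂` and `ρ₅`; the exponent for `ρ₃`. For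
`f` and `g` only the letters differ: the leftmost `ε` decides `f`, the rightmost `η` decides `g`. -/
theorem oriented_SC : CatAlg.Oriented lt₂ SC := by
  intro X Y u v h
  change WtLt (WtLt TLt IdxLt) IdxLt (EpsWord.wt (decomp v)) (EpsWord.wt (decomp u))
  have hcons {α : Type} (r : α → α → Prop) (a b : α) (l l' : List α) :
      List.Lex r (a :: l) (b :: l') ↔ r a b ∨ a = b ∧ List.Lex r l l' := by
    constructor
    · rintro (_ | h | h)
      exacts [.inl ‹_›, .inr ⟨rfl, ‹_›⟩]
    · rintro (h | ⟨rfl, h⟩)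
      exacts [.rel h, .cons h]
  rcases h with h | h <;> cases h <;>
    simp only [decomp_comp_eps, decomp_comp_eta, decomp_comp_t, decomp_eps, decomp_eta, decomp_t,
      decomp_id, decomp_tpow, consLetter, EpsWord.wt, EtaWord.wt, wtLt_iff, hcons, List.map_cons,
      List.map_nil, List.reverse_cons, List.reverse_nil, List.length_cons, List.length_nil,
      List.nil_append, List.cons_append, TLt, IdxLt, Prod.lex_def, Prod.mk.injEq] <;> grind

end Cyc

namespace Cyc

/-! ### Words as quasi-periodic maps `ℤ → ℤ` -/

/-- The quasi-periodic map `ℤ → ℤ` of a letter. -/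
def Letter.eval : Letter → ℤ → ℤ
  | .eps p i, x => x + (x + p - i) / p
  | .eta q j, x => x - (x + q + 1 - j) / (q + 2)
  | .t _, x => x - 1

/-- The quasi-periodic map `ℤ → ℤ` of a word. -/
def evalWord : List Letter → ℤ → ℤ
  | [], x => x
  | l :: ls, x => l.eval (evalWord ls x)

theorem evalWord_append (l l' : List Letter) (x : ℤ) :
    evalWord (l ++ l') x = evalWord l (evalWord l' x) := by
  induction l with
  | nil => rfl
  | cons a l ih => simp [evalWord, ih]

/-- The quotient in `Letter.eval` is constant on windows one period long. The windows treated in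
this and the next three lemmas show that `ε` skips `i` and `η` repeats `j`. -/
theorem eval_eps_of_lt {p i : ℕ} {x : ℤ} (h : (i : ℤ) ≤ x + p) (h' : x < i) :
    (Letter.eps p i).eval x = x := by
  rw [Letter.eval, Int.ediv_eq_zero_of_lt (by omega) (by omega), add_zero]

theorem eval_eps_of_ge {p i : ℕ} {x : ℤ} (h : (i : ℤ) ≤ x) (h' : x < i + p) :
    (Letter.eps p i).eval x = x + 1 := by
  have : (x + p - i) / (p : ℤ) = 1 := by
    rw [show x + p - i = (x - i) + p by ring, Int.add_ediv_of_dvd_right (dvd_refl _),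
      Int.ediv_self (by omega), Int.ediv_eq_zero_of_lt (by omega) (by omega), zero_add]
  rw [Letter.eval, this]

theorem eval_eta_of_le {q j : ℕ} {x : ℤ} (h : (j : ℤ) ≤ x + q + 1) (h' : x ≤ j) :
    (Letter.eta q j).eval x = x := by
  rw [Letter.eval, Int.ediv_eq_zero_of_lt (by omega) (by omega), sub_zero]

theorem eval_eta_of_gt {q j : ℕ} {x : ℤ} (h : (j : ℤ) < x) (h' : x ≤ j + q + 2) :
    (Letter.eta q j).eval x = x - 1 := by
  have : (x + q + 1 - j) / ((q : ℤ) + 2) = 1 := by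
    rw [show x + q + 1 - j = (x - j - 1) + ((q : ℤ) + 2) by ring,
      Int.add_ediv_of_dvd_right (dvd_refl _), Int.ediv_self (by omega),
      Int.ediv_eq_zero_of_lt (by omega) (by omega), zero_add]
  rw [Letter.eval, this]

/-- `f` maps `x + (q + 1)` to `f x + (p + 1)`. -/
def QuasiPeriodic (q p : ℕ) (f : ℤ → ℤ) : Prop := ∀ x, f (x + (q + 1)) = f x + (p + 1)

theorem QuasiPeriodic.comp {q p r : ℕ} {f g : ℤ → ℤ} (hf : QuasiPeriodic q p f)
    (hg : QuasiPeriodic p r g) : QuasiPeriodic q r fun x => g (f x) := fun x => by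
  change g (f (x + (q + 1))) = g (f x) + (r + 1)
  rw [hf, hg]

theorem QuasiPeriodic.add_mul {q p : ℕ} {f : ℤ → ℤ} (hf : QuasiPeriodic q p f) (x c : ℤ) :
    f (x + c * (q + 1)) = f x + c * (p + 1) := by
  induction c using Int.induction_on generalizing x with
  | zero => simp
  | succ n ih =>
    rw [show x + ((n : ℤ) + 1) * (q + 1) = (x + n * (q + 1)) + (q + 1) by ring, hf, ih]
    ring
  | pred n ih =>
    have := hf (x + (-(n : ℤ) - 1) * (q + 1))
    rw [show x + (-(n : ℤ) - 1) * (q + 1) + (q + 1) = x + -(n : ℤ) * (q + 1) by ring, ih] at this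
    linarith

theorem QuasiPeriodic.ext {q p : ℕ} {f g : ℤ → ℤ} (hf : QuasiPeriodic q p f)
    (hg : QuasiPeriodic q p g) (h : ∀ x : ℤ, 0 ≤ x → x ≤ q → f x = g x) (x : ℤ) : f x = g x := by
  have e : x = x % (q + 1) + x / (q + 1) * (q + 1) := by
    rw [mul_comm]; exact (Int.emod_add_mul_ediv x (q + 1)).symm
  rw [e, hf.add_mul, hg.add_mul, h _ (Int.emod_nonneg _ (by omega))
    (by have := Int.emod_lt_of_pos x (show (0 : ℤ) < q + 1 by omega); omega)]

theorem quasiPeriodic_edge {a b : Vertex} (e : Edge a b) :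
    QuasiPeriodic a.idx b.idx (Edge.letter e).eval := by
  intro x
  cases e with
  | eps p i h =>
    simp only [Edge.letter, Letter.eval]
    rw [show x + ((p : ℤ) + 1) + ((p + 1 : ℕ) : ℤ) - i = (x + ((p + 1 : ℕ) : ℤ) - i)
      + ((p + 1 : ℕ) : ℤ) by push_cast; ring, Int.add_ediv_of_dvd_right (dvd_refl _),
      Int.ediv_self (by omega)]
    push_cast
    ring
  | eta q j h =>
    simp only [Edge.letter, Letter.eval]
    rw [show x + (((q + 1 : ℕ) : ℤ) + 1) + q + 1 - j = (x + q + 1 - j) + ((q : ℤ) + 2) by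
      push_cast; ring, Int.add_ediv_of_dvd_right (dvd_refl _), Int.ediv_self (by omega)]
    push_cast
    ring
  | t q =>
    simp only [Edge.letter, Letter.eval]
    ring

/-- The quasi-periodic map `ℤ → ℤ` of a path. -/
def evalPath {a b : Vertex} (u : Quiver.Path a b) : ℤ → ℤ := evalWord (letters u)

theorem quasiPeriodic_path {a b : Vertex} (u : Quiver.Path a b) :
    QuasiPeriodic a.idx b.idx (evalPath u) := by
  induction u with
  | nil => intro x; rfl
  | cons u e ih => exact ih.comp (quasiPeriodic_edge e)

theorem letters_comp {a b c : Vertex} (u : Quiver.Path a b) (v : Quiver.Path b c) :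
    letters (u.comp v) = letters v ++ letters u := by
  induction v with
  | nil => rfl
  | cons v e ih => rw [Quiver.Path.comp_cons, letters, ih, letters, List.cons_append]

theorem evalPath_comp {a b c : Vertex} (u : Quiver.Path a b) (v : Quiver.Path b c) (x : ℤ) :
    evalPath (u.comp v) x = evalPath v (evalPath u x) := by
  rw [evalPath, letters_comp, evalWord_append]
  rfl

theorem evalPath_comp_hom {a b c : CY} (u : a ⟶ b) (v : b ⟶ c) (x : ℤ) :
    evalPath (u ≫ v) x = evalPath v (evalPath u x) :=
  evalPath_comp u v x

theorem letters_tpow (q n : ℕ) : letters (tpow q n) = List.replicate n (Letter.t q) := by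
  induction n with
  | zero => rfl
  | succ n ih =>
    change Letter.t q :: letters (tpow q n) = _
    rw [ih, List.replicate_succ]

theorem evalWord_replicate_t (q n : ℕ) (x : ℤ) :
    evalWord (List.replicate n (Letter.t q)) x = x - n := by
  induction n with
  | zero => simp [evalWord]
  | succ n ih => rw [List.replicate_succ, evalWord, ih, Letter.eval]; push_cast; ring

/-- By quasi-periodicity it suffices to compare one period, where these are the cosimplicial
identities and their rotations. Only `ρ₃` needs a nonzero `c`: `t_q^{q+1}` is translation by minus
one period. -/
theorem evalPath_SC {a b : CY} {u v : a ⟶ b} (h : SC u v) :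
    ∃ c : ℤ, ∀ x, evalPath u x = evalPath v x + c * ((Vertex.idx b : ℕ) + 1) := by
  have key {u v : a ⟶ b}
      (H : ∀ x : ℤ, 0 ≤ x → x ≤ (Vertex.idx a : ℕ) → evalPath u x = evalPath v x) :
      ∃ c : ℤ, ∀ x, evalPath u x = evalPath v x + c * ((Vertex.idx b : ℕ) + 1) :=
    ⟨0, fun x => by
      rw [zero_mul, add_zero]
      exact (quasiPeriodic_path u).ext (quasiPeriodic_path v) H x⟩
  rcases h with h | h
  · cases h with
    | f q i j hij hj =>
      refine key fun x (h0 : 0 ≤ x) (hx : x ≤ (q : ℕ)) => ?_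
      change (Letter.eps (q + 1 + 1) i).eval ((Letter.eps (q + 1) j).eval x)
        = (Letter.eps (q + 1 + 1) (j + 1)).eval ((Letter.eps (q + 1) i).eval x)
      rcases lt_or_ge x i with h1 | h1 <;> rcases lt_or_ge x j with h2 | h2 <;>
        first | omega | simp (disch := omega) only [eval_eps_of_lt, eval_eps_of_ge]
    | g q i j hij hj =>
      refine key fun x (h0 : 0 ≤ x) (hx : x ≤ (q + 1 + 1 : ℕ)) => ?_
      change (Letter.eta q j).eval ((Letter.eta (q + 1) i).eval x)
        = (Letter.eta q i).eval ((Letter.eta (q + 1) (j + 1)).eval x)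
      rcases le_or_gt x i with h1 | h1 <;> rcases le_or_gt x (j + 1) with h2 | h2 <;>
        rcases le_or_gt x j with h3 | h3 <;> try omega
      all_goals simp (disch := omega) only [eval_eta_of_le, eval_eta_of_gt]
    | h_lt q i j hij hj =>
      refine key fun x (h0 : 0 ≤ x) (hx : x ≤ (q + 1 : ℕ)) => ?_
      change (Letter.eta (q + 1) (j + 1)).eval ((Letter.eps (q + 1 + 1) i).eval x)
        = (Letter.eps (q + 1) i).eval ((Letter.eta q j).eval x)
      rcases lt_or_ge x i with h1 | h1 <;> rcases le_or_gt x j with h2 | h2 <;> try omega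
      all_goals simp (disch := omega) only [eval_eta_of_le, eval_eta_of_gt, eval_eps_of_lt,
        eval_eps_of_ge]
      all_goals omega
    | h_eq q j hj =>
      refine key fun x (h0 : 0 ≤ x) (hx : x ≤ (q : ℕ)) => ?_
      change (Letter.eta q j).eval ((Letter.eps (q + 1) j).eval x) = x
      rcases lt_or_ge x j with h1 | h1
      all_goals simp (disch := omega) only [eval_eta_of_le, eval_eta_of_gt, eval_eps_of_lt,
        eval_eps_of_ge]
      all_goals omega
    | h_succ q j hj =>
      refine key fun x (h0 : 0 ≤ x) (hx : x ≤ (q : ℕ)) => ?_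
      change (Letter.eta q j).eval ((Letter.eps (q + 1) (j + 1)).eval x) = x
      rcases le_or_gt x j with h1 | h1
      all_goals simp (disch := omega) only [eval_eta_of_le, eval_eta_of_gt, eval_eps_of_lt,
        eval_eps_of_ge]
      all_goals omega
    | h_gt q i j hij hi =>
      refine key fun x (h0 : 0 ≤ x) (hx : x ≤ (q + 1 : ℕ)) => ?_
      change (Letter.eta (q + 1) j).eval ((Letter.eps (q + 1 + 1) (i + 1)).eval x)
        = (Letter.eps (q + 1) i).eval ((Letter.eta q j).eval x)
      rcases lt_or_ge x (i + 1) with h1 | h1 <;> rcases le_or_gt x j with h2 | h2 <;> try omega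
      all_goals simp (disch := omega) only [eval_eta_of_le, eval_eta_of_gt, eval_eps_of_lt,
        eval_eps_of_ge]
      all_goals omega
    | rho1 q i hi =>
      refine key fun x (h0 : 0 ≤ x) (hx : x ≤ (q : ℕ)) => ?_
      change (Letter.eps (q + 1) (i + 1)).eval x - 1 = (Letter.eps (q + 1) i).eval (x - 1)
      rcases lt_or_ge x (i + 1) with h1 | h1
      all_goals simp (disch := omega) only [eval_eps_of_lt, eval_eps_of_ge]
      all_goals omega
    | rho2 q i hi =>
      refine key fun x (h0 : 0 ≤ x) (hx : x ≤ (q + 1 : ℕ)) => ?_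
      change (Letter.eta q (i + 1)).eval x - 1 = (Letter.eta q i).eval (x - 1)
      rcases le_or_gt x (i + 1) with h1 | h1
      all_goals simp (disch := omega) only [eval_eta_of_le, eval_eta_of_gt]
    | rho3 q =>
      refine ⟨-1, fun x => ?_⟩
      change evalWord (letters (tpow q (q + 1))) x = x + -1 * ((q : ℤ) + 1)
      rw [letters_tpow, evalWord_replicate_t]
      push_cast
      ring
  · cases h with
    | rho4 q =>
      refine key fun x (h0 : 0 ≤ x) (hx : x ≤ (q : ℕ)) => ?_
      change (Letter.eps (q + 1) 0).eval x - 1 = (Letter.eps (q + 1) (q + 1)).eval x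
      simp (disch := omega) only [eval_eps_of_lt, eval_eps_of_ge]
      omega
    | rho5 q =>
      refine key fun x (h0 : 0 ≤ x) (hx : x ≤ (q + 1 : ℕ)) => ?_
      change (Letter.eta q 0).eval x - 1 = (Letter.eta q q).eval (x - 1 - 1)
      rcases le_or_gt x 0 with h1 | h1
      · obtain rfl : x = 0 := by omega
        -- The point `-2` lies just below the window covered by `eval_eta_of_le`; adding the period
        -- `q + 2` moves it to `q`.
        have h2 : (Letter.eta q q).eval (-2 + ((q + 1 : ℕ) + 1))
            = (Letter.eta q q).eval (-2) + (q + 1) :=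
          quasiPeriodic_edge (Edge.eta q q le_rfl) (-2)
        simp (disch := omega) only [eval_eta_of_le] at h2 ⊢
        norm_num
        omega
      · simp (disch := omega) only [eval_eta_of_le, eval_eta_of_gt]

/-- A translation by `c` periods passes through a quasi-periodic map as a translation by `c` periods
of the target. The relation `R` is left open so that both `S` and `SC` are covered. -/
theorem exists_evalPath_eq_of_map_eq {R : HomRel CY}
    (hR : ∀ {a b : CY} {u v : a ⟶ b}, R u v → SC u v)
    {a b : CY} {u v : a ⟶ b} (h : (Quotient.functor R).map u = (Quotient.functor R).map v) :
    ∃ c : ℤ, ∀ x, evalPath u x = evalPath v x + c * ((Vertex.idx b : ℕ) + 1) := by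
  have h' := CatAlg.eqvGen_of_map_eq h
  clear h
  induction h' with
  | rel u v h =>
    obtain ⟨A, B, f, m₁, m₂, g, hm⟩ := h
    obtain ⟨c, hc⟩ := evalPath_SC (hR hm)
    refine ⟨c, fun x => ?_⟩
    rw [evalPath_comp_hom, evalPath_comp_hom, evalPath_comp_hom, evalPath_comp_hom, hc,
      (quasiPeriodic_path g).add_mul]
  | refl u => exact ⟨0, fun x => by ring⟩
  | symm u v _ ih =>
    obtain ⟨c, hc⟩ := ih
    exact ⟨-c, fun x => by rw [hc]; ring⟩
  | trans u v w _ _ h1 h2 =>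
    obtain ⟨c, hc⟩ := h1
    obtain ⟨d, hd⟩ := h2
    exact ⟨d + c, fun x => by rw [hc, hd]; ring⟩

/-! ### A normal form is determined by its quasi-periodic map -/

/-- The word `η_c^{j₁} η_{c+1}^{j₂} ...`. -/
def etaWord (c : ℕ) (js : List ℕ) : List Letter := js.mapIdx fun b j => Letter.eta (c + b) j

/-- The word `ε_p^{i₁} ε_{p-1}^{i₂} ...`. -/
def epsWord (p : ℕ) (is : List ℕ) : List Letter := is.mapIdx fun a i => Letter.eps (p - a) i

theorem etaWord_cons (c j : ℕ) (js : List ℕ) :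
    etaWord c (j :: js) = Letter.eta c j :: etaWord (c + 1) js := by
  simp [etaWord, List.mapIdx_cons, Nat.add_assoc, Nat.add_comm 1]

theorem epsWord_cons (p i : ℕ) (is : List ℕ) :
    epsWord p (i :: is) = Letter.eps p i :: epsWord (p - 1) is := by
  simp [epsWord, List.mapIdx_cons, Nat.sub_sub, Nat.add_comm 1]

theorem add_length_le_of_pairwise_lt {j m : ℕ} {l : List ℕ} (h : (j :: l).Pairwise (· < ·))
    (hm : ∀ x ∈ j :: l, x < m) : j + l.length < m := by
  induction l generalizing j with
  | nil => simpa using hm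
  | cons b l ih =>
    have h1 := ih (List.pairwise_cons.1 h).2 fun x hx => hm x (List.mem_cons_of_mem _ hx)
    have h2 := (List.pairwise_cons.1 h).1 b (by simp)
    rw [List.length_cons]
    omega

/-- The map of `etaWord c js` on `0, ..., q` is the monotone surjection onto `0, ..., c` that is
constant exactly on the pairs `j, j + 1` with `j ∈ js`. -/
theorem evalWord_etaWord {c q : ℕ} {js : List ℕ} (h : js.Pairwise (· < ·)) (hq : ∀ j ∈ js, j < q)
    (hc : c + js.length = q) :
    (∀ x m : ℕ, m ≤ x → x ≤ q → (∀ j ∈ js, m ≤ j) → (m : ℤ) ≤ evalWord (etaWord c js) x) ∧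
    (∀ x : ℕ, x ≤ q → (∀ j ∈ js, x ≤ j) → evalWord (etaWord c js) x = x) ∧
    (∀ x : ℕ, x < q → evalWord (etaWord c js) (x + 1 : ℕ) =
      evalWord (etaWord c js) x + if x ∈ js then 0 else 1) ∧
    (∀ x : ℕ, x ≤ q → 0 ≤ evalWord (etaWord c js) x ∧ evalWord (etaWord c js) x ≤ c) ∧
    (∀ y : ℤ, 0 ≤ y → y ≤ c → ∃ x : ℕ, x ≤ q ∧ evalWord (etaWord c js) x = y) := by
  induction js generalizing c with
  | nil =>
    simp only [List.length_nil, add_zero] at hc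
    subst hc
    simp only [etaWord, List.mapIdx_nil, evalWord]
    refine ⟨by intros; omega, by simp, by simp, by intros; omega, fun y h0 h1 => ?_⟩
    exact ⟨y.toNat, by omega, by omega⟩
  | cons j js ih =>
    have hjc := add_length_le_of_pairwise_lt h hq
    rw [List.length_cons] at hc
    obtain ⟨hj, hjs⟩ := List.pairwise_cons.1 h
    obtain ⟨i1, i2, i3, i4, i5⟩ := ih hjs (fun x hx => hq x (by simp [hx]))
      (show c + 1 + js.length = q by omega)
    rw [etaWord_cons]
    simp only [evalWord]
    set φ : ℕ → ℤ := fun x => evalWord (etaWord (c + 1) js) x with hφ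
    have hlow (x : ℕ) (hx : x ≤ q) : evalWord (etaWord (c + 1) js) x ≤ j →
        (Letter.eta c j).eval (φ x) = φ x := fun h =>
      eval_eta_of_le (by have := i4 x hx; simp only [hφ]; omega) h
    have hhigh (x : ℕ) (hx : x ≤ q) : (j : ℤ) < evalWord (etaWord (c + 1) js) x →
        (Letter.eta c j).eval (φ x) = φ x - 1 := fun h =>
      eval_eta_of_gt h (by have := i4 x hx; simp only [hφ]; omega)
    simp only [hφ] at hlow hhigh
    -- The remaining indices exceed `j`, so the inner map fixes `0, ..., j + 1`, and the pair merged
    -- by the new letter is `j, j + 1` itself.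
    have hlej (x : ℕ) (hx : x ≤ j + 1) : evalWord (etaWord (c + 1) js) x = x :=
      i2 x (by omega) fun y hy => by have := hj y hy; omega
    refine ⟨fun x m hm hx hall => ?_, fun x hx hall => ?_, fun x hx => ?_, fun x hx => ?_,
      fun y h0 h1 => ?_⟩
    · have hmj := hall j (by simp)
      have h1 := i1 x m hm hx fun y hy => hall y (by simp [hy])
      rcases le_or_gt (evalWord (etaWord (c + 1) js) x) j with h2 | h2
      · rw [hlow x hx h2]; exact h1
      · rw [hhigh x hx h2]; omega
    · have hxj := hall j (by simp)
      have e := hlej x (by omega)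
      rw [hlow x hx (by omega), e]
    · have e := i3 x hx
      rcases lt_trichotomy x j with h1 | rfl | h1
      · have e1 := hlej x (by omega)
        have e2 := hlej (x + 1) (by omega)
        have hn : x ∉ j :: js := by
          rw [List.mem_cons, not_or]
          exact ⟨by omega, fun hx => by have := hj x hx; omega⟩
        rw [hlow x (by omega) (by omega), hlow (x + 1) (by omega) (by omega), e1, e2, if_neg hn]
        push_cast
        ring
      · have e1 := hlej x (by omega)
        have e2 := hlej (x + 1) (by omega)
        rw [hlow x (by omega) (by omega), hhigh (x + 1) (by omega) (by omega), e1, e2,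
          if_pos (by simp)]
        push_cast
        ring
      -- Beyond `j` both inner values exceed `j`; both drop by `1` and their difference is
      -- unchanged.
      · have l1 := i1 x (j + 1) (by omega) (by omega) fun y hy => hj y hy
        have l2 := i1 (x + 1) (j + 1) (by omega) (by omega) fun y hy => hj y hy
        rw [hhigh x (by omega) (by omega), hhigh (x + 1) (by omega) (by omega), e]
        have : (x ∈ j :: js) ↔ x ∈ js := by
          rw [List.mem_cons, or_iff_right (by omega)]
        simp only [this]
        ring
    · have h1 := i4 x hx
      rcases le_or_gt (evalWord (etaWord (c + 1) js) x) j with h2 | h2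
      · rw [hlow x hx h2]; omega
      · rw [hhigh x hx h2]; omega
    · rcases le_or_gt y j with h2 | h2
      · obtain ⟨x, hx, e⟩ := i5 y h0 (by omega)
        exact ⟨x, hx, by rw [hlow x hx (by omega), e]⟩
      · obtain ⟨x, hx, e⟩ := i5 (y + 1) (by omega) (by omega)
        exact ⟨x, hx, by rw [hhigh x hx (by omega), e]; ring⟩

/-- The map of `epsWord p is` on `0, ..., p - m` is an injection into `0, ..., p` whose image is the
complement of `is`. -/
theorem evalWord_epsWord {p m : ℕ} {is : List ℕ} (h : is.Pairwise (· > ·)) (hp : ∀ i ∈ is, i ≤ p)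
    (hm : m + is.length = p) :
    (∀ x : ℤ, 0 ≤ x → x ≤ m → 0 ≤ evalWord (epsWord p is) x ∧ evalWord (epsWord p is) x ≤ p) ∧
    (∀ x y : ℤ, 0 ≤ x → x ≤ m → 0 ≤ y → y ≤ m →
      evalWord (epsWord p is) x = evalWord (epsWord p is) y → x = y) ∧
    (∀ z : ℕ, z ≤ p → ((∃ x : ℤ, 0 ≤ x ∧ x ≤ m ∧ evalWord (epsWord p is) x = z) ↔ z ∉ is)) := by
  induction is generalizing p with
  | nil =>
    simp only [List.length_nil, add_zero] at hm
    subst hm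
    simp only [epsWord, List.mapIdx_nil, evalWord]
    refine ⟨by intros; omega, by intros; omega, fun z hz => ?_⟩
    exact ⟨fun _ => by simp, fun _ => ⟨z, by omega, by omega, rfl⟩⟩
  | cons i is ih =>
    rw [List.length_cons] at hm
    obtain ⟨hi, his⟩ := List.pairwise_cons.1 h
    have hip := hp i (by simp)
    obtain ⟨i1, i2, i3⟩ := ih his (p := p - 1) (fun x hx => by have := hi x hx; omega) (by omega)
    rw [epsWord_cons]
    simp only [evalWord]
    have hlow (x : ℤ) (h0 : 0 ≤ x) (hx : x ≤ m) : evalWord (epsWord (p - 1) is) x < i →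
        (Letter.eps p i).eval (evalWord (epsWord (p - 1) is) x)
          = evalWord (epsWord (p - 1) is) x := fun h =>
      eval_eps_of_lt (by have := i1 x h0 hx; omega) h
    have hhigh (x : ℤ) (h0 : 0 ≤ x) (hx : x ≤ m) : (i : ℤ) ≤ evalWord (epsWord (p - 1) is) x →
        (Letter.eps p i).eval (evalWord (epsWord (p - 1) is) x)
          = evalWord (epsWord (p - 1) is) x + 1 := fun h =>
      eval_eps_of_ge h (by have := i1 x h0 hx; omega)
    refine ⟨fun x h0 hx => ?_, fun x y hx0 hx hy0 hy he => i2 x y hx0 hx hy0 hy ?_,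
      fun z hz => ?_⟩
    · have h1 := i1 x h0 hx
      rcases lt_or_ge (evalWord (epsWord (p - 1) is) x) i with h2 | h2
      · rw [hlow x h0 hx h2]; omega
      · rw [hhigh x h0 hx h2]; omega
    · rcases lt_or_ge (evalWord (epsWord (p - 1) is) x) i with h2 | h2 <;>
        rcases lt_or_ge (evalWord (epsWord (p - 1) is) y) i with h3 | h3
      · rwa [hlow x hx0 hx h2, hlow y hy0 hy h3] at he
      · rw [hlow x hx0 hx h2, hhigh y hy0 hy h3] at he; omega
      · rw [hhigh x hx0 hx h2, hlow y hy0 hy h3] at he; omega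
      · rw [hhigh x hx0 hx h2, hhigh y hy0 hy h3] at he; omega
    · constructor
      · rintro ⟨x, h0, hx, e⟩ hmem
        have h1 := i1 x h0 hx
        rcases lt_or_ge (evalWord (epsWord (p - 1) is) x) i with h2 | h2
        · rw [hlow x h0 hx h2] at e
          rcases List.mem_cons.1 hmem with rfl | hmem
          · omega
          · exact (i3 z (by omega)).1 ⟨x, h0, hx, e⟩ hmem
        · rw [hhigh x h0 hx h2] at e
          rcases List.mem_cons.1 hmem with rfl | hmem
          · omega
          · have := hi z hmem
            omega
      · intro hmem
        rw [List.mem_cons, not_or] at hmem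
        rcases lt_or_ge z i with h2 | h2
        · obtain ⟨x, h0, hx, e⟩ := (i3 z (by omega)).2 hmem.2
          exact ⟨x, h0, hx, by rw [hlow x h0 hx (by omega), e]⟩
        -- Here `z > i`, so `z` is hit through `z - 1 ≥ i`, which the inner map does not miss
        -- because its missed values are below `i`.
        · obtain ⟨x, h0, hx, e⟩ := (i3 (z - 1) (by omega)).2 fun h => by
            have := hi _ h
            omega
          exact ⟨x, h0, hx, by rw [hhigh x h0 hx (by omega), e]; omega⟩

theorem NormalForm.word_eq {q p : ℕ} (N : NormalForm q p) :
    N.word = epsWord p N.is ++ etaWord (q - N.js.length) N.js ++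
      List.replicate N.e (Letter.t q) := rfl

/-- The map of the part `ε ... ε η ... η` of a normal form. -/
def NormalForm.core {q p : ℕ} (N : NormalForm q p) (x : ℤ) : ℤ :=
  evalWord (epsWord p N.is) (evalWord (etaWord (q - N.js.length) N.js) x)

theorem NormalForm.evalWord_word {q p : ℕ} (N : NormalForm q p) (x : ℤ) :
    evalWord N.word x = N.core (x - N.e) := by
  rw [N.word_eq, evalWord_append, evalWord_append, evalWord_replicate_t]
  rfl

theorem NormalForm.length_js_le {q p : ℕ} (N : NormalForm q p) : N.js.length ≤ q := by
  have h1 := N.js_increasing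
  have h2 := N.js_lt
  revert h1 h2
  cases N.js with
  | nil => simp
  | cons j js =>
    intro h1 h2
    have := add_length_le_of_pairwise_lt h1 h2
    rw [List.length_cons]
    omega

/-- The core is a surjection followed by an injection, so its repetitions come from the `η` part
alone and its missed values from the `ε` part alone. -/
theorem NormalForm.core_spec {q p : ℕ} (N : NormalForm q p) :
    (∀ x : ℕ, x ≤ q → 0 ≤ N.core x ∧ N.core x ≤ p) ∧
    (∀ x : ℕ, x < q → (N.core (x + 1 : ℕ) = N.core x ↔ x ∈ N.js)) ∧
    (∀ z : ℕ, z ≤ p → ((∃ x : ℕ, x ≤ q ∧ N.core x = z) ↔ z ∉ N.is)) := by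
  have hl := N.length_js_le
  have hle := N.length_eq
  obtain ⟨-, -, h3, h4, h5⟩ := evalWord_etaWord N.js_increasing N.js_lt
    (show q - N.js.length + N.js.length = q by omega)
  obtain ⟨e1, e2, e3⟩ := evalWord_epsWord N.is_decreasing N.is_le
    (show q - N.js.length + N.is.length = p by omega)
  refine ⟨fun x hx => e1 _ (h4 x hx).1 (h4 x hx).2, fun x hx => ?_, fun z hz => ?_⟩
  · have hs := h3 x hx
    constructor
    · intro h
      have := e2 _ _ (h4 _ hx).1 (h4 _ hx).2 (h4 x hx.le).1 (h4 x hx.le).2 h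
      by_contra hn
      rw [if_neg hn, this] at hs
      omega
    · intro h
      rw [if_pos h, add_zero] at hs
      simp only [NormalForm.core, hs]
  · rw [← e3 z hz]
    constructor
    · rintro ⟨x, hx, h⟩
      exact ⟨_, (h4 x hx).1, (h4 x hx).2, h⟩
    · rintro ⟨y, h0, hy, h⟩
      obtain ⟨x, hx, rfl⟩ := h5 y h0 hy
      exact ⟨x, hx, h⟩

theorem shift_eq_zero {p : ℕ} {a b c : ℤ} (ha : 0 ≤ a ∧ a ≤ p) (hb : 0 ≤ b ∧ b ≤ p)
    (h : a = b + c * (p + 1)) : c = 0 := by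
  by_contra hc
  rcases lt_or_gt_of_ne hc with hc | hc
  · nlinarith
  · nlinarith

/-- Suppose `e < e'`. At `x = e'` both sides are values in `0, ..., p` up to `c` periods, so `c =
0`. At `x = e` the left side is `f 0 ≥ 0`, while `g (e - e')` is one period below a value in `0,
..., p`, hence negative. -/
theorem rotation_le {q p e e' : ℕ} {f g : ℤ → ℤ} {c : ℤ} (hg : QuasiPeriodic q p g)
    (hf' : ∀ x : ℕ, x ≤ q → 0 ≤ f x ∧ f x ≤ p) (hg' : ∀ x : ℕ, x ≤ q → 0 ≤ g x ∧ g x ≤ p)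
    (he' : e' ≤ q) (h : ∀ x : ℤ, f (x - e) = g (x - e') + c * (p + 1)) : e' ≤ e := by
  by_contra! hlt
  have h1 := h e'
  rw [show (e' : ℤ) - e = ((e' - e : ℕ) : ℤ) by omega, sub_self] at h1
  obtain rfl := shift_eq_zero (hf' _ (by omega)) (hg' 0 (by omega)) h1
  have h2 := h e
  have h3 := hg (e - e')
  rw [show (e : ℤ) - e' + (q + 1) = ((q + 1 - (e' - e) : ℕ) : ℤ) by omega] at h3
  have h4 := hg' (q + 1 - (e' - e)) (by omega)
  have h5 := hf' 0 (by omega)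
  rw [sub_self] at h2
  simp only [Nat.cast_zero] at h5
  omega

theorem eq_of_mem_iff_of_pairwise {r : ℕ → ℕ → Prop} [Std.Irrefl r] [Std.Antisymm r]
    {l l' : List ℕ} (h : l.Pairwise r) (h' : l'.Pairwise r) (hm : ∀ x, x ∈ l ↔ x ∈ l') :
    l = l' := by
  have d {l : List ℕ} (h : l.Pairwise r) : l.Nodup := h.imp fun {a b} hab => by
    rintro rfl
    exact irrefl_of r a hab
  exact List.Perm.eq_of_pairwise' h h' ((List.perm_ext_iff_of_nodup (d h) (d h')).2 hm)

/-- Comparing rotations in both directions gives `e = e'`; removing them forces `c = 0`, so the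
cores agree, and sorted lists are determined by their members. -/
theorem NormalForm.eq_of_evalWord {q p : ℕ} {N N' : NormalForm q p}
    (hN : QuasiPeriodic q p (evalWord N.word)) (hN' : QuasiPeriodic q p (evalWord N'.word)) {c : ℤ}
    (h : ∀ x, evalWord N.word x = evalWord N'.word x + c * (p + 1)) : N = N' := by
  have hqp {N : NormalForm q p} (hN : QuasiPeriodic q p (evalWord N.word)) :
      QuasiPeriodic q p N.core := fun x => by
    have := hN (x + N.e)
    rw [N.evalWord_word, N.evalWord_word, add_sub_cancel_right,
      show x + N.e + ((q : ℤ) + 1) - N.e = x + (q + 1) by ring] at this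
    exact this
  simp only [NormalForm.evalWord_word] at h
  obtain ⟨r, s, im⟩ := N.core_spec
  obtain ⟨r', s', im'⟩ := N'.core_spec
  have he : N.e = N'.e := by
    refine le_antisymm ?_ ?_
    · refine rotation_le (c := -c) (hqp hN) r' r N.e_le fun x => ?_
      rw [h]
      ring
    · exact rotation_le (hqp hN') r r' N'.e_le h
  have h0 (x : ℤ) : N.core x = N'.core x + c * (p + 1) := by
    have := h (x + N.e)
    rwa [← he, add_sub_cancel_right] at this
  obtain rfl := shift_eq_zero (r 0 (by omega)) (r' 0 (by omega)) (h0 _)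
  have hc : N.core = N'.core := by
    funext x
    rw [h0]
    ring
  rw [hc] at s im
  have his : N.is = N'.is := by
    refine eq_of_mem_iff_of_pairwise N.is_decreasing N'.is_decreasing fun z => ?_
    rcases le_or_gt z p with hz | hz
    · exact not_iff_not.1 ((im z hz).symm.trans (im' z hz))
    · exact ⟨fun h => absurd (N.is_le z h) (by omega), fun h => absurd (N'.is_le z h) (by omega)⟩
  have hjs : N.js = N'.js := by
    refine eq_of_mem_iff_of_pairwise N.js_increasing N'.js_increasing fun x => ?_
    rcases lt_or_ge x q with hx | hx
    · exact (s x hx).symm.trans (s' x hx)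
    · exact ⟨fun h => absurd (N.js_lt x h) (by omega), fun h => absurd (N'.js_lt x h) (by omega)⟩
  exact NormalForm.ext his hjs he

end Cyc

namespace Cyc

/-! ### Words that are not normal are reducible -/

theorem letters_injective {a b : Vertex} (u : Quiver.Path a b) :
    ∀ v : Quiver.Path a b, letters u = letters v → u = v := by
  induction u with
  | nil =>
    intro v h
    cases v with
    | nil => rfl
    | cons v e => simp [letters] at h
  | @cons b c u e ih =>
    intro v h
    change Edge b c at e
    cases v with
    | nil => simp [letters] at h
    | @cons b' _ v e' =>
      change Edge b' c at e'
      cases e <;> cases e' <;>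
        simp only [letters, Edge.letter, List.cons.injEq, Letter.eps.injEq, Letter.eta.injEq,
          reduceCtorEq, false_and, true_and] at h
      · obtain ⟨rfl, h⟩ := h
        rw [ih v h]
      · obtain ⟨rfl, h⟩ := h
        rw [ih v h]
      · rw [ih v h]

/-- The word of the path is a normal form. -/
def IsNormalWord {a b : Vertex} (u : Quiver.Path a b) : Prop :=
  ∃ N : NormalForm a.idx b.idx, letters u = N.word

/-- The path contains the larger side of a relation. -/
def IsReducible {a b : CY} (u : a ⟶ b) : Prop :=
  ∃ (A B : CY) (w : a ⟶ A) (s s' : A ⟶ B) (w' : B ⟶ b), SC s s' ∧ u = w ≫ s ≫ w'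

theorem IsReducible.comp {a b c : CY} {u : a ⟶ b} (h : IsReducible u) (v : b ⟶ c) :
    IsReducible (u ≫ v) := by
  obtain ⟨A, B, w, s, s', w', hs, rfl⟩ := h
  exact ⟨A, B, w, s, s', w' ≫ v, hs, by simp⟩

theorem SC.isReducible {a b c : CY} {s s' : b ⟶ c} (h : SC s s') (u : a ⟶ b) :
    IsReducible (u ≫ s) :=
  ⟨b, c, u, s, s', 𝟙 c, h, by simp⟩

/-- The normal form `t_q^e`. -/
def NormalForm.ofT (q e : ℕ) (h : e ≤ q) : NormalForm q q :=
  ⟨[], [], e, by simp, by simp, by simp, by simp, h, by simp⟩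

theorem exists_eps_of_letters {q p P i : ℕ} {u : obj q ⟶ obj p} {l : List Letter}
    (h : letters u = Letter.eps P i :: l) :
    ∃ (p' : ℕ) (hp : p = p' + 1) (u' : obj q ⟶ obj p') (hi : i ≤ p' + 1), letters u' = l ∧
      u = hp ▸ (u' ≫ eps p' i hi) := by
  change Quiver.Path (⟨q⟩ : Vertex) ⟨p⟩ at u
  cases u with
  | nil => simp [letters] at h
  | @cons b _ u e =>
    change Edge b ⟨p⟩ at e
    cases e with
    | eps p' i' hi =>
      simp only [letters, Edge.letter, List.cons.injEq, Letter.eps.injEq] at h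
      obtain ⟨⟨-, rfl⟩, rfl⟩ := h
      exact ⟨p', rfl, u, hi, rfl, rfl⟩
    | eta _ j hj => simp [letters, Edge.letter] at h
    | t => simp [letters, Edge.letter] at h

theorem exists_eta_of_letters {q p P j : ℕ} {u : obj q ⟶ obj p} {l : List Letter}
    (h : letters u = Letter.eta P j :: l) :
    ∃ (u' : obj q ⟶ obj (p + 1)) (hj : j ≤ p), letters u' = l ∧ u = u' ≫ eta p j hj := by
  change Quiver.Path (⟨q⟩ : Vertex) ⟨p⟩ at u
  cases u with
  | nil => simp [letters] at h
  | @cons b _ u e =>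
    change Edge b ⟨p⟩ at e
    cases e with
    | eps p' i' hi => simp [letters, Edge.letter] at h
    | eta _ j' hj =>
      simp only [letters, Edge.letter, List.cons.injEq, Letter.eta.injEq] at h
      obtain ⟨⟨-, rfl⟩, rfl⟩ := h
      exact ⟨u, hj, rfl, rfl⟩
    | t => simp [letters, Edge.letter] at h

theorem isReducible_eps_comp_eta {p i j : ℕ} (hi : i ≤ p + 1) (hj : j ≤ p) {a : CY}
    (u : a ⟶ obj p) : IsReducible (u ≫ eps p i hi ≫ eta p j hj) := by
  rcases lt_trichotomy i j with h | rfl | h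
  · obtain ⟨p, rfl⟩ : ∃ p', p = p' + 1 := ⟨p - 1, by omega⟩
    obtain ⟨j, rfl⟩ : ∃ j', j = j' + 1 := ⟨j - 1, by omega⟩
    exact SC.isReducible (.inl (.h_lt p i j (by omega) (by omega))) u
  · exact SC.isReducible (.inl (.h_eq p i hj)) u
  · obtain ⟨i, rfl⟩ : ∃ i', i = i' + 1 := ⟨i - 1, by omega⟩
    rcases Nat.eq_or_lt_of_le (Nat.le_of_lt_succ h) with rfl | h
    · exact SC.isReducible (.inl (.h_succ p j hj)) u
    · obtain ⟨p, rfl⟩ : ∃ p', p = p' + 1 := ⟨p - 1, by omega⟩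
      exact SC.isReducible (.inl (.h_gt p i j h (by omega))) u

/-- `ρ₁` omits the index `0`; this gap is what `ρ₄` fills, as `ρ₅` does for `η`. -/
theorem isReducible_eps_comp_t {p i : ℕ} (hi : i ≤ p + 1) {a : CY} (u : a ⟶ obj p) :
    IsReducible (u ≫ eps p i hi ≫ t (p + 1)) := by
  cases i with
  | zero => exact SC.isReducible (.inr (.rho4 p)) u
  | succ i => exact SC.isReducible (.inl (.rho1 p i (by omega))) u

theorem isReducible_eta_comp_t {q j : ℕ} (hj : j ≤ q) {a : CY} (u : a ⟶ obj (q + 1)) :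
    IsReducible (u ≫ eta q j hj ≫ t q) := by
  cases j with
  | zero => exact SC.isReducible (.inr (.rho5 q)) u
  | succ j => exact SC.isReducible (.inl (.rho2 q j hj)) u

/-- The list is decreasing, so if `i` cannot be put in front, its first entry is already at least
`i` and the two leading letters form the left side of `f`. -/
theorem normal_or_reducible_comp_eps {q p i : ℕ} (hi : i ≤ p + 1) (u : obj q ⟶ obj p)
    (N : NormalForm q p) (hN : letters u = N.word) :
    (∃ N' : NormalForm q (p + 1), letters (u ≫ eps p i hi) = N'.word) ∨
      IsReducible (u ≫ eps p i hi) := by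
  have hl : letters (u ≫ eps p i hi) = Letter.eps (p + 1) i :: letters u := rfl
  by_cases h : ∀ x ∈ N.is, x < i
  · refine .inl ⟨⟨i :: N.is, N.js, N.e, List.pairwise_cons.2 ⟨h, N.is_decreasing⟩,
      List.forall_mem_cons.2 ⟨hi, fun x hx => (N.is_le x hx).trans (by omega)⟩, N.js_increasing,
      N.js_lt, N.e_le, ?_⟩, ?_⟩
    · have := N.length_eq
      rw [List.length_cons]
      omega
    · rw [hl, hN, NormalForm.word_eq, NormalForm.word_eq, epsWord_cons]
      rfl
  · right
    obtain ⟨is, js, e, h1, h2, h3, h4, h5, h6⟩ := N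
    cases is with
    | nil => simp at h
    | cons i' is =>
      have hle : i ≤ i' := by
        by_contra! hlt
        exact h (List.forall_mem_cons.2 ⟨hlt, fun x hx =>
          ((List.pairwise_cons.1 h1).1 x hx).trans hlt⟩)
      rw [NormalForm.word_eq, epsWord_cons] at hN
      obtain ⟨p', rfl, u', hi', -, rfl⟩ := exists_eps_of_letters hN
      rw [Category.assoc]
      exact SC.isReducible (.inl (.f p' i i' hle hi')) u'

theorem normal_or_reducible_comp_eta {q p j : ℕ} (hj : j ≤ p) (u : obj q ⟶ obj (p + 1))
    (N : NormalForm q (p + 1)) (hN : letters u = N.word) :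
    (∃ N' : NormalForm q p, letters (u ≫ eta p j hj) = N'.word) ∨
      IsReducible (u ≫ eta p j hj) := by
  have hl : letters (u ≫ eta p j hj) = Letter.eta p j :: letters u := rfl
  obtain ⟨is, js, e, h1, h2, h3, h4, h5, h6⟩ := N
  cases is with
  | cons i is =>
    rw [NormalForm.word_eq, epsWord_cons] at hN
    obtain ⟨p', hp, u', hi, -, rfl⟩ := exists_eps_of_letters hN
    obtain rfl : p = p' := by omega
    right
    rw [Category.assoc]
    exact isReducible_eps_comp_eta hi hj u'
  | nil =>
    rw [List.length_nil, add_zero] at h6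
    by_cases h : ∀ x ∈ js, j < x
    · refine .inl ⟨⟨[], j :: js, e, by simp, by simp, List.pairwise_cons.2 ⟨h, h3⟩,
        List.forall_mem_cons.2 ⟨by omega, h4⟩, h5, ?_⟩, ?_⟩
      · rw [List.length_nil, List.length_cons]
        omega
      · rw [hl, hN, NormalForm.word_eq, NormalForm.word_eq]
        simp only [List.length_cons]
        rw [show q - (js.length + 1) = p by omega, show q - js.length = p + 1 by omega,
          etaWord_cons]
        rfl
    · right
      cases js with
      | nil => simp at h
      | cons j' js =>
        have hle : j' ≤ j := by
          by_contra! hlt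
          exact h (List.forall_mem_cons.2 ⟨hlt, fun x hx =>
            hlt.trans ((List.pairwise_cons.1 h3).1 x hx)⟩)
        rw [NormalForm.word_eq] at hN
        simp only [etaWord_cons, epsWord, List.mapIdx_nil, List.nil_append, List.cons_append] at hN
        obtain ⟨u', hj', -, rfl⟩ := exists_eta_of_letters hN
        rw [Category.assoc]
        exact SC.isReducible (.inl (.g p j' j hle hj)) u'

theorem normal_or_reducible_comp_t {q p : ℕ} (u : obj q ⟶ obj p) (N : NormalForm q p)
    (hN : letters u = N.word) :
    (∃ N' : NormalForm q p, letters (u ≫ t p) = N'.word) ∨ IsReducible (u ≫ t p) := by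
  have hl : letters (u ≫ t p) = Letter.t p :: letters u := rfl
  obtain ⟨is, js, e, h1, h2, h3, h4, h5, h6⟩ := N
  cases is with
  | cons i is =>
    rw [NormalForm.word_eq, epsWord_cons] at hN
    obtain ⟨p', rfl, u', hi, -, rfl⟩ := exists_eps_of_letters hN
    right
    rw [Category.assoc]
    exact isReducible_eps_comp_t hi u'
  | nil =>
    cases js with
    | cons j js =>
      rw [NormalForm.word_eq] at hN
      simp only [etaWord_cons, epsWord, List.mapIdx_nil, List.nil_append, List.cons_append] at hN
      obtain ⟨u', hj, -, rfl⟩ := exists_eta_of_letters hN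
      right
      rw [Category.assoc]
      exact isReducible_eta_comp_t hj u'
    | nil =>
      obtain rfl : q = p := by simpa using h6
      have hN' : letters u = List.replicate e (Letter.t q) := hN
      -- At the maximal exponent one more `t` completes the left side of `ρ₃`, the only case where
      -- more than two letters may be involved.
      rcases Nat.eq_or_lt_of_le h5 with rfl | h5
      · right
        obtain rfl : u = tpow e e := letters_injective _ _ (hN'.trans (letters_tpow e e).symm)
        have := SC.isReducible (.inl (.rho3 e)) (𝟙 (obj e))
        rwa [Category.id_comp] at this
      · refine .inl ⟨.ofT q (e + 1) h5, ?_⟩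
        rw [hl, hN', ← List.replicate_succ]
        rfl

theorem normal_or_reducible {a b : Vertex} (u : Quiver.Path a b) :
    IsNormalWord u ∨ IsReducible (a := a) (b := b) u := by
  induction u with
  | nil => exact .inl ⟨.ofT a.idx 0 (Nat.zero_le _), rfl⟩
  | @cons b c u e ih =>
    rcases ih with ⟨N, hN⟩ | h
    · change Edge b c at e
      cases e with
      | eps p i hi => exact normal_or_reducible_comp_eps hi u N hN
      | eta q j hj => exact normal_or_reducible_comp_eta hj u N hN
      | t q => exact normal_or_reducible_comp_t u N hN
    · exact .inr (h.comp (Quiver.Hom.toPath e))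

/-! ### The normal forms represent the morphisms of the cyclic category uniquely -/

/-- Used with `SC` for the Groebner-Shirshov criterion and with `S` for the morphisms of `Λ`. -/
theorem normalForm_unique {R : HomRel CY} (hR : ∀ {a b : CY} {u v : a ⟶ b}, R u v → SC u v)
    {q p : ℕ} {u v : obj q ⟶ obj p} {N N' : NormalForm q p} (hN : letters u = N.word)
    (hN' : letters v = N'.word)
    (h : (Quotient.functor R).map u = (Quotient.functor R).map v) : N = N' := by
  obtain ⟨c, hc⟩ := exists_evalPath_eq_of_map_eq hR h
  have hu := quasiPeriodic_path u
  have hv := quasiPeriodic_path v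
  simp only [evalPath, hN, hN'] at hc hu hv
  exact NormalForm.eq_of_evalWord hu hv hc

theorem isNormalFamily_SC :
    CatAlg.IsNormalFamily SC fun (a b : CY) (u : a ⟶ b) => IsNormalWord (a := a) (b := b) u where
  reducible _ _ u := normal_or_reducible u
  unique := by
    rintro a b u v ⟨N, hN⟩ ⟨N', hN'⟩ h
    obtain rfl := normalForm_unique (fun h => h) hN hN' h
    exact letters_injective u v (hN.trans hN'.symm)

/-! ### `ρ₄` and `ρ₅` hold in `Λ`. -/

theorem tpow_add (q m n : ℕ) : tpow q (m + n) = tpow q m ≫ tpow q n := by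
  induction n with
  | zero => exact (Category.comp_id _).symm
  | succ n ih => rw [← Nat.add_assoc, tpow, ih, tpow, Category.assoc]

theorem tpow_succ' (q n : ℕ) : tpow q (n + 1) = t q ≫ tpow q n := by
  rw [Nat.add_comm, tpow_add]
  simp [tpow]

theorem toLam_map_tpow_succ (q : ℕ) : toLam.map (tpow q (q + 1)) = 𝟙 _ :=
  (CategoryTheory.Quotient.sound S (.rho3 q)).trans (toLam.map_id _)

theorem toLam_map_eps_comp_tpow (q i : ℕ) (hi : i ≤ q + 1) :
    toLam.map (eps q i hi) ≫ toLam.map (tpow (q + 1) i) =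
      toLam.map (tpow q i) ≫ toLam.map (eps q 0 (by omega)) := by
  induction i with
  | zero => simp [tpow]
  | succ i ih =>
    have h := CategoryTheory.Quotient.sound S (.rho1 q i (by omega))
    rw [tpow_succ', tpow_succ', ← Functor.map_comp, ← Category.assoc,
      Functor.map_comp, h, ← Functor.map_comp, Category.assoc, Functor.map_comp, Functor.map_comp,
      ih (by omega), Functor.map_comp, Category.assoc]

theorem toLam_map_eta_comp_tpow (q j : ℕ) (hj : j ≤ q) :
    toLam.map (eta q j hj) ≫ toLam.map (tpow q j) =
      toLam.map (tpow (q + 1) j) ≫ toLam.map (eta q 0 (by omega)) := by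
  induction j with
  | zero => simp [tpow]
  | succ j ih =>
    have h := CategoryTheory.Quotient.sound S (.rho2 q j hj)
    rw [tpow_succ', tpow_succ', ← Functor.map_comp, ← Category.assoc,
      Functor.map_comp, h, ← Functor.map_comp, Category.assoc, Functor.map_comp, Functor.map_comp,
      ih (by omega), Functor.map_comp, Category.assoc]

/-- Iterating `ρ₁` down from the top index gives `t^{q+1} ε^{q+1} = ε^0 t^{q+1} = ε^0`; one more `t`
on the left turns this into `t ε^0 = ε^{q+1}`, since `t_{q+1}^{q+2} = 1`. Likewise `t^q η^q = η^0
t^q`; multiplying by `t^2` on the right gives `η^0 = t^q η^q t^2`, and a `t` on the left cancels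
`t^q`. -/
theorem toLam_map_eq_of_rho45 {a b : CY} {u v : a ⟶ b} (h : Rho45 u v) :
    toLam.map u = toLam.map v := by
  cases h with
  | rho4 q =>
    have h1 := toLam_map_eps_comp_tpow q (q + 1) le_rfl
    rw [toLam_map_tpow_succ, Category.id_comp] at h1
    have h2 := toLam_map_tpow_succ (q + 1)
    rw [tpow, Functor.map_comp] at h2
    rw [Functor.map_comp, ← h1, Category.assoc, h2, Category.comp_id]
  | rho5 q =>
    have h1 := toLam_map_eta_comp_tpow q q le_rfl
    have h2 := toLam_map_tpow_succ (q + 1)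
    rw [show q + 1 + 1 = 2 + q by omega, tpow_add, Functor.map_comp] at h2
    have h3 := toLam_map_tpow_succ q
    rw [tpow, Functor.map_comp] at h3
    have h4 : toLam.map (eta q 0 (by omega)) = toLam.map (tpow (q + 1) 2) ≫
        toLam.map (eta q q le_rfl) ≫ toLam.map (tpow q q) := by
      rw [h1, ← Category.assoc, h2, Category.id_comp]
    rw [Functor.map_comp, h4, Functor.map_comp, Category.assoc, Category.assoc, h3,
      Category.comp_id]

theorem toLam_map_eq_of_SC {a b : CY} {u v : a ⟶ b} (h : SC u v) :
    toLam.map u = toLam.map v :=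
  h.elim (fun h => CategoryTheory.Quotient.sound S h) toLam_map_eq_of_rho45

theorem toLam_map_eq_of_quotient_SC {a b : CY} {u v : a ⟶ b}
    (h : (Quotient.functor SC).map u = (Quotient.functor SC).map v) :
    toLam.map u = toLam.map v := by
  have h' := CatAlg.eqvGen_of_map_eq h
  clear h
  induction h' with
  | rel u v h =>
    obtain ⟨A, B, f, m₁, m₂, g, hm⟩ := h
    simp only [Functor.map_comp, toLam_map_eq_of_SC hm]
  | refl u => rfl
  | symm u v _ ih => exact ih.symm
  | trans u v w _ _ h1 h2 => exact h1.trans h2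

theorem Id_polys_SC (k : Type*) [Field k] :
    CatAlg.Id (CatAlg.polys k SC) = CatAlg.Id (CatAlg.polys k S) := by
  funext X Y
  ext f
  constructor
  · refine CatAlg.MemIdeal.le ?_
    rintro X Y _ ⟨u, v, h, rfl⟩
    exact CatAlg.memIdeal_word_sub_word (toLam_map_eq_of_SC h)
  · refine CatAlg.MemIdeal.le ?_
    rintro X Y _ ⟨u, v, h, rfl⟩
    exact .of ⟨u, v, .inl h, rfl⟩

theorem existsUnique_normalForm (q p : ℕ) (μ : toLam.obj (obj q) ⟶ toLam.obj (obj p)) :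
    ∃! N : NormalForm q p, N.Represents μ := by
  obtain ⟨u, rfl⟩ := toLam.map_surjective μ
  -- Only the congruence of `u` with a normal word is used, so the field `ℚ` is an arbitrary choice.
  obtain ⟨n, ⟨N, hN⟩, h, -⟩ := CatAlg.exists_normal_sub_mem_trivialMod isMonomialOrder_lt₂
    oriented_SC isNormalFamily_SC ℚ u
  refine ⟨N, ⟨n, hN, (toLam_map_eq_of_quotient_SC h).symm⟩, ?_⟩
  rintro N' ⟨n', hN', h'⟩
  exact normalForm_unique .inl hN' hN (h'.trans (toLam_map_eq_of_quotient_SC h))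

end Cyc

end

theorem theorem5p2 (k : Type*) [Field k] :
    -- `Id(S^C) = Id(S)`
    CatAlg.Id (CatAlg.polys k Cyc.SC) = CatAlg.Id (CatAlg.polys k Cyc.S) ∧
    -- `S^C` is a Groebner-Shirshov basis with respect to `≻₂`,
    CatAlg.IsGroebnerShirshovBasis Cyc.lt₂ (CatAlg.polys k Cyc.SC) ∧
    -- for `kC(Y|S)`: its ideal is the kernel of the canonical map `kC(Y) → kC(Y|S)`.
    (∀ (X Y : Cyc.CY) (f : CatAlg.Poly k X Y),
      f ∈ CatAlg.Id (CatAlg.polys k Cyc.SC) (X := X) (Y := Y) ↔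
        CatAlg.toQuotient Cyc.S f = 0) ∧
    -- Every morphism of the cyclic category has a unique normal form.
    ∀ (q p : ℕ) (μ : Cyc.toLam.obj (Cyc.obj q) ⟶ Cyc.toLam.obj (Cyc.obj p)),
      ∃! N : Cyc.NormalForm q p, N.Represents μ := by
  refine ⟨Cyc.Id_polys_SC k, ?_, fun X Y f => ?_, Cyc.existsUnique_normalForm⟩
  · exact CatAlg.isGroebnerShirshovBasis_polys Cyc.isMonomialOrder_lt₂ Cyc.oriented_SC
      Cyc.isNormalFamily_SC ⟨_, _, _, _, .inl (.rho3 0)⟩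
  · rw [Cyc.Id_polys_SC k]
    exact CatAlg.memIdeal_iff_toQuotient_eq_zero Cyc.S f
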